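/- Let $\mathfrak g_0$ be a linearly compact topological real Lie algebra, i.e. a real Lie algebra with a Hausdorff topological vector space structure for which the Lie product is continuous and in which every family of closed affine subspaces with the finite intersection property has nonempty intersection. Let $\mathfrak i_0\subseteq\mathfrak g_0$ be a closed Lie subalgebra of finite codimension containing no nonzero ideal of $\mathfrak g_0$ (so $(\mathfrak g_0,\mathfrak i_0)$ is a transitive pair), let $V$ be a linear complement of $\mathfrak i_0$ in $\mathfrak g_0$, and let $\pi:\mathfrak g_0\to V$ be the projection along $\mathfrak i_0$. Let $\mathcal F$ be the ring of formal power series on $V$ (in linear coordinates on $V$, $\mathcal F=\mathbb R[[t_1,\dots,t_n]]$) and $\mathrm{Der}(\mathcal F)=\mathcal F\otimes_{\mathbb R}V$ the Lie algebra of its derivations; $\Theta(0)\in V$ denotes the value at $0$ of $\Theta\in\mathrm{Der}(\mathcal F)$. Define $b_h$ by $\sum_{h\ge0}b_ht^h=\frac{t}{1-e^{-t}}$. For $X\in\mathfrak g_0$ let $L_X^*,R_X^*\in\mathrm{Der}(\mathcal F)$ be the formal vector fields on $V$ uniquely determined by the identities of formal power series in $v\in V$ $$\sum_{h\ge0}b_h(\mathrm{ad}\,v)^h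 X=L_X^*(v)+\sum_{r\ge0}b_r(\mathrm{ad}\,v)^r H(v),\qquad \sum_{h\ge0}(-1)^hb_h(\mathrm{ad}\,v)^h X=R_X^*(v)+\sum_{r\ge0}b_r(\mathrm{ad}\,v)^r H'(v),$$ where $L_X^*,R_X^*$ have values in $V$ and $H,H'$ are formal power series in $v$ with values in $\mathfrak i_0$. Put $\mathfrak g_0^*=\{R_X^*\mid X\in\mathfrak g_0\}$. Let $\mathfrak g=\mathbb C\otimes\mathfrak g_0$, $\mathfrak i=\mathbb C\otimes\mathfrak i_0$, $V^{\mathbb C}=\mathbb C\otimes V$, and extend $Y\mapsto L_Y^*$, $\pi$ and $\Theta\mapsto\Theta(0)$ by $\mathbb C$-linearity to maps $\mathfrak g\to\mathbb C\otimes\mathrm{Der}(\mathcal F)$, $\mathfrak g\to V^{\mathbb C}$ and $\mathbb C\otimes\mathrm{Der}(\mathcal F)\to V^{\mathbb C}$. Then the correspondence sending $\mathfrak l$ to the $\mathbb C\otimes\mathcal F$-submodule $$\mathfrak l^*=(\mathbb C\otimes\mathcal F)\cdot\langle L_w^*\mid w\in V^{\mathbb C}\cap\mathfrak l\rangle$$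 of $\mathbb C\otimes\mathrm{Der}(\mathcal F)$ is a bijection from the set of $\mathfrak i$-submodules $\mathfrak l$ of $\mathfrak g$ (complex linear subspaces with $[\mathfrak i,\mathfrak l]\subseteq\mathfrak l$) that contain $\mathfrak i$ onto the set of $\mathbb C\otimes\mathcal F$-submodules $M$ of $\mathbb C\otimes\mathrm{Der}(\mathcal F)$ that are $\mathfrak g_0^*$-invariant ($[\mathfrak g_0^*,M]\subseteq M$). Its inverse is $$M\longmapsto\{Y\in\mathfrak g\mid \pi(Y)=\Theta(0)\ \text{for some}\ \Theta\in M\}.$$ -/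

import Mathlib

open scoped TensorProduct

noncomputable section

namespace TransPair

/-! ### Transitive pairs -/

/-- Linear compactness: every family of closed affine subspaces with the finite intersection
property has a common point. -/
def IsLinearlyCompact (E : Type*) [AddCommGroup E] [Module ℝ E] [TopologicalSpace E] : Prop :=
  ∀ 𝒜 : Set (AffineSubspace ℝ E), (∀ A ∈ 𝒜, IsClosed (A : Set E)) →
    (∀ ℬ : Set (AffineSubspace ℝ E), ℬ ⊆ 𝒜 → ℬ.Finite → (⋂ A ∈ ℬ, (A : Set E)).Nonempty) →
    (⋂ A ∈ 𝒜, (A : Set E)).Nonempty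

/-- `g` is a linearly compact topological Lie algebra: a Hausdorff topological vector space with
continuous Lie product which is linearly compact. Only the continuity of each single
homothety `x ↦ c • x` is required, so that both usual conventions for the topology of the scalar
field (Euclidean or discrete) are covered. -/
structure IsLinearlyCompactLieAlgebra (g : Type*) [LieRing g] [LieAlgebra ℝ g]
    [TopologicalSpace g] : Prop where
  isTopologicalAddGroup : IsTopologicalAddGroup g
  continuousConstSMul : ContinuousConstSMul ℝ g
  t2Space : T2Space g
  continuous_lie : Continuous fun p : g × g => ⁅p.1, p.2⁆
  linearlyCompact : IsLinearlyCompact g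

/-- `(g, i)` is a transitive pair. -/
structure IsTransitivePair (g : Type*) [LieRing g] [LieAlgebra ℝ g] [TopologicalSpace g]
    (i : LieSubalgebra ℝ g) : Prop where
  linearlyCompactLieAlgebra : IsLinearlyCompactLieAlgebra g
  isClosed : IsClosed (i : Set g)
  finiteCodim : FiniteDimensional ℝ (g ⧸ i.toSubmodule)
  ideal_eq_bot : ∀ I : LieIdeal ℝ g, (∀ x ∈ I, x ∈ i) → I = ⊥

/-! ### Formal power series and formal vector fields

A basis `e` of `V` indexed by `ι` gives coordinates `t i` on `V`, and the ring of formal power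
series associated to `V` is `ℝ⟦t⟧`: the form `α` of degree `h` corresponds to the homogeneous
polynomial `α (v, …, v)` at the generic point `v = ∑ i, t i • e i`. -/

/-- The ring of formal power series. -/
abbrev FPS (ι : Type*) := MvPowerSeries ι ℝ

/-- The Lie algebra of derivations of the ring of formal power series. -/
abbrev Der (ι : Type*) := Derivation ℝ (FPS ι) (FPS ι)

/-- The action of `ℂ ⊗ 𝓕` on `ℂ ⊗ Der 𝓕`, `(a ⊗ f) • (c ⊗ D) = (a * c) ⊗ (f • D)`. -/
def actionHom (ι : Type*) : (ℂ ⊗[ℝ] FPS ι) →ₐ[ℂ] Module.End ℂ (ℂ ⊗[ℝ] Der ι) :=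
  Algebra.TensorProduct.lift (Algebra.ofId ℂ _)
    ((Module.End.baseChangeHom ℝ ℂ (Der ι)).comp (Algebra.lsmul ℝ ℝ (Der ι)))
    (fun a _ => by rw [Algebra.ofId_apply]; exact Algebra.commute_algebraMap_left a _)

instance instModuleComplexDer (ι : Type*) : Module (ℂ ⊗[ℝ] FPS ι) (ℂ ⊗[ℝ] Der ι) :=
  Module.compHom _ (actionHom ι).toRingHom

theorem tmul_smul_tmul {ι : Type*} (a c : ℂ) (f : FPS ι) (D : Der ι) :
    (a ⊗ₜ[ℝ] f : ℂ ⊗[ℝ] FPS ι) • (c ⊗ₜ[ℝ] D : ℂ ⊗[ℝ] Der ι) = (a * c) ⊗ₜ[ℝ] (f • D) := by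
  change actionHom ι (a ⊗ₜ[ℝ] f) (c ⊗ₜ[ℝ] D) = _
  rw [actionHom, Algebra.TensorProduct.lift_tmul]
  rfl

theorem tmul_one_smul {ι : Type*} (a : ℂ) (T : ℂ ⊗[ℝ] Der ι) :
    (a ⊗ₜ[ℝ] (1 : FPS ι) : ℂ ⊗[ℝ] FPS ι) • T = a • T := by
  change actionHom ι (a ⊗ₜ[ℝ] 1) T = _
  rw [actionHom, Algebra.TensorProduct.lift_tmul, map_one, mul_one]
  rfl

/-! ### The fields `L_X^*` and `R_X^*` -/

/-- The coefficients `b_h`. -/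
def bCoeff (h : ℕ) : ℝ := ((bernoulli' h / h.factorial : ℚ) : ℝ)

/-- `∑ b_h t^h = t / (1 - exp (-t))`. -/
theorem bCoeff_generating :
    PowerSeries.mk bCoeff * (1 - PowerSeries.evalNegHom (PowerSeries.exp ℝ)) = PowerSeries.X := by
  have hb : PowerSeries.mk bCoeff = bernoulli'PowerSeries ℝ := by
    ext n; simp [bCoeff, bernoulli'PowerSeries]
  have h1 := bernoulli'PowerSeries_mul_exp_sub_one ℝ
  have h2 := PowerSeries.exp_mul_exp_neg_eq_one (A := ℝ)
  rw [hb]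
  linear_combination (PowerSeries.evalNegHom (PowerSeries.exp ℝ)) * h1 +
    (PowerSeries.X - bernoulli'PowerSeries ℝ) * h2

section Fields

variable {g : Type*} [LieRing g] [LieAlgebra ℝ g]

/-- The operator `ad v` on formal power series with coefficients in `g`, at the generic point
`v = ∑ i, t i • e i`. A series with coefficients in `g` is the family of its coefficients, indexed
by the exponents of the monomials. -/
def adGen {ι : Type*} (e : ι → g) : Module.End ℝ ((ι →₀ ℕ) → g) where
  toFun f m := ∑ i ∈ m.support, ⁅e i, f (m - Finsupp.single i 1)⁆
  map_add' f f' := by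
    funext m; simp [Finset.sum_add_distrib]
  map_smul' c f := by
    funext m; simp [Finset.smul_sum]

open Classical in
/-- The constant series `X`. -/
def constSeries (ι : Type*) : g →ₗ[ℝ] ((ι →₀ ℕ) → g) :=
  LinearMap.single ℝ (fun _ => g) 0

variable {i₀ : LieSubalgebra ℝ g} {V : Submodule ℝ g}

/-- The projection `g → V` along `i₀`. -/
def proj (hV : IsCompl V i₀.toSubmodule) : g →ₗ[ℝ] V := V.projectionOnto i₀.toSubmodule hV

/-- The homogeneous term of degree `h` of the `i₀`-valued series `H` determined by
`∑ c_h (ad v)^h X = Y (v) + ∑ b_r (ad v)^r H (v)`, with `Y` a series with values in `V`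
and `H` one with values in `i₀`. -/
def isoTerm (hV : IsCompl V i₀.toSubmodule) {ι : Type*} (e : Module.Basis ι ℝ V) (c : ℕ → ℝ) :
    ℕ → (g →ₗ[ℝ] ((ι →₀ ℕ) → g))
  | h => ((LinearMap.id - V.subtype ∘ₗ proj hV).compLeft (ι →₀ ℕ)) ∘ₗ
      (c h • (((adGen fun j => (e j : g)) ^ h) ∘ₗ constSeries ι) -
        ∑ r : Fin h, bCoeff (r + 1) •
          (((adGen fun j => (e j : g)) ^ ((r : ℕ) + 1)) ∘ₗ isoTerm hV e c (h - 1 - r)))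
  decreasing_by have := r.isLt; omega

/-- The homogeneous term of degree `h` of the `V`-valued series `Y` determined by
`∑ c_h (ad v)^h X = Y (v) + ∑ b_r (ad v)^r H (v)`. -/
def fieldTerm (hV : IsCompl V i₀.toSubmodule) {ι : Type*} (e : Module.Basis ι ℝ V) (c : ℕ → ℝ)
    (h : ℕ) : g →ₗ[ℝ] ((ι →₀ ℕ) → V) :=
  ((proj hV).compLeft (ι →₀ ℕ)) ∘ₗ
      (c h • (((adGen fun j => (e j : g)) ^ h) ∘ₗ constSeries ι) -
        ∑ r : Fin h, bCoeff (r + 1) •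
          (((adGen fun j => (e j : g)) ^ ((r : ℕ) + 1)) ∘ₗ isoTerm hV e c (h - 1 - r)))

/-- The `j`-th coordinate of the series `∑ h, fieldTerm h X`. The term of degree `h` is homogeneous
of degree `h`, so the coefficient at a monomial is that of the term of its degree. -/
def fieldCoord (hV : IsCompl V i₀.toSubmodule) {ι : Type*} (e : Module.Basis ι ℝ V) (c : ℕ → ℝ)
    (j : ι) : g →ₗ[ℝ] FPS ι where
  toFun X := fun m => e.coord j (fieldTerm hV e c m.degree X m)
  map_add' X Y := by
    funext m
    change e.coord j (fieldTerm hV e c m.degree (X + Y) m) =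
      e.coord j (fieldTerm hV e c m.degree X m) + e.coord j (fieldTerm hV e c m.degree Y m)
    rw [map_add, Pi.add_apply, map_add]
  map_smul' a X := by
    funext m
    change e.coord j (fieldTerm hV e c m.degree (a • X) m) =
      a • e.coord j (fieldTerm hV e c m.degree X m)
    rw [map_smul, Pi.smul_apply, map_smul]

/-- The formal vector field with the given series as coordinates, as a derivation. -/
def field (hV : IsCompl V i₀.toSubmodule) {ι : Type*} [Fintype ι] (e : Module.Basis ι ℝ V)
    (c : ℕ → ℝ) : g →ₗ[ℝ] Der ι where
  toFun X := ∑ j, fieldCoord hV e c j X • MvPowerSeries.pderiv ℝ j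
  map_add' X Y := by simp [add_smul, Finset.sum_add_distrib]
  map_smul' a X := by simp [Finset.smul_sum]

/-- The map `X ↦ L_X^*`. -/
def fieldL (hV : IsCompl V i₀.toSubmodule) {ι : Type*} [Fintype ι] (e : Module.Basis ι ℝ V) :
    g →ₗ[ℝ] Der ι := field hV e bCoeff

/-- The map `X ↦ R_X^*`. -/
def fieldR (hV : IsCompl V i₀.toSubmodule) {ι : Type*} [Fintype ι] (e : Module.Basis ι ℝ V) :
    g →ₗ[ℝ] Der ι := field hV e fun h => (-1) ^ h * bCoeff h

/-- The value at `0` of a formal vector field, as a vector of `V`. -/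
def evalZero {ι : Type*} [Fintype ι] (e : Module.Basis ι ℝ V) : Der ι →ₗ[ℝ] V where
  toFun D := ∑ j, MvPowerSeries.constantCoeff (D (MvPowerSeries.X j)) • e j
  map_add' D D' := by simp [add_smul, Finset.sum_add_distrib]
  map_smul' a D := by
    simp [Finset.smul_sum, mul_smul]

/-! ### The correspondence -/

/-- The set of `i`-submodules of `ℂ ⊗ g` containing `i`, where `i` is the complexification of
`i₀`. -/
def isotropySubmodules (i₀ : LieSubalgebra ℝ g) : Set (Submodule ℂ (ℂ ⊗[ℝ] g)) :=
  {l | i₀.toSubmodule.baseChange ℂ ≤ l ∧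
    ∀ X ∈ i₀.toSubmodule.baseChange ℂ, ∀ Y ∈ l, ⁅X, Y⁆ ∈ l}

/-- The set of `ℂ ⊗ 𝓕`-submodules of `ℂ ⊗ Der 𝓕` invariant under all `R_X^*` with `X ∈ g`. -/
def invariantModules (hV : IsCompl V i₀.toSubmodule) {ι : Type*} [Fintype ι]
    (e : Module.Basis ι ℝ V) : Set (Submodule (ℂ ⊗[ℝ] FPS ι) (ℂ ⊗[ℝ] Der ι)) :=
  {M | ∀ X : g, ∀ T ∈ M, ⁅((1 : ℂ) ⊗ₜ[ℝ] fieldR hV e X : ℂ ⊗[ℝ] Der ι), T⁆ ∈ M}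

/-- The module `l^*` generated over `ℂ ⊗ 𝓕` by the `L_w^*` with `w` in the intersection of `l` with
the complexification of `V`; here `w ↦ L_w^*` is extended by `ℂ`-linearity. -/
def starModule (hV : IsCompl V i₀.toSubmodule) {ι : Type*} [Fintype ι] (e : Module.Basis ι ℝ V)
    (l : Submodule ℂ (ℂ ⊗[ℝ] g)) : Submodule (ℂ ⊗[ℝ] FPS ι) (ℂ ⊗[ℝ] Der ι) :=
  Submodule.span (ℂ ⊗[ℝ] FPS ι)
    {T | ∃ w ∈ V.baseChange ℂ ⊓ l, T = (fieldL hV e).baseChange ℂ w}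

/-- The space of all `Y ∈ ℂ ⊗ g` whose projection to the complexification of `V` is the value
at `0` of an element of `M`. -/
def valueSubmodule (hV : IsCompl V i₀.toSubmodule) {ι : Type*} [Fintype ι]
    (e : Module.Basis ι ℝ V) (M : Submodule (ℂ ⊗[ℝ] FPS ι) (ℂ ⊗[ℝ] Der ι)) :
    Submodule ℂ (ℂ ⊗[ℝ] g) where
  carrier := {Y | ∃ T ∈ M, (proj hV).baseChange ℂ Y = (evalZero e).baseChange ℂ T}
  zero_mem' := ⟨0, M.zero_mem, by simp⟩
  add_mem' := by
    rintro Y Y' ⟨T, hT, h⟩ ⟨T', hT', h'⟩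
    exact ⟨T + T', M.add_mem hT hT', by rw [map_add, map_add, h, h']⟩
  smul_mem' := by
    rintro a Y ⟨T, hT, h⟩
    refine ⟨a • T, ?_, by rw [map_smul, map_smul, h]⟩
    rw [← tmul_one_smul]
    exact M.smul_mem _ hT

end Fields

end TransPair

end

open scoped TensorProduct

noncomputable section

namespace TransPair

open Finset.HasAntidiagonal (antidiagonal mem_antidiagonal)

/-! ### Formal power series with coefficients in a real vector space -/

/-! Let `θ = (1 - exp (-ad v)) / ad v` be the Maurer-Cartan form on formal vector fields (`mcForm`).
Dividing the defining identities by `∑ b_r (ad v)^r` gives `θ(L_X^*) = X - H` and `θ(R_X^*) = exp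
(-ad v) X - H'`, with `H`, `H'` valued in `i₀` (`mcForm_fieldL`, `mcForm_fieldR`). Projecting `θ` to
`V` (`comps`) therefore sends `L_w^*`, for `w` in `V`, to the constant `w`. These components
determine a field (`comps_injective`), so the `L_w^*` form a frame.

The Maurer-Cartan equation (`act_mcForm`) and the flatness of `exp (-ad v) X` (`act_expNeg`) come
from one uniqueness principle: `(E + n + ad v) s = 0`, with `E` the Euler operator and `n > 0`,
forces `s = 0`. Together they show (`comps_fieldR_lie`) that bracketing with `R_X^*` differentiates
the components along `R_X^*` and subtracts the isotropy action of the coefficients of `H'`.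

For an `i`-submodule `l` containing `i`, put `W = l ∩ V^ℂ`. Then `l^*` consists of all fields whose
components have coefficients in `W` (`starModule_eq_coeffModule`). It is invariant because `W` is
stable under isotropy, and its values at `0` give back `W`, hence `l = W + i`.

Conversely let `W` be the space of values at `0` of an invariant `M`. Since `R_{e_j}^*` is `∂_j` at
the origin, bracketing with it exposes the coefficients one degree higher, and induction on the
degree puts them all in `W` (`le_coeffModule_of_invariant`). So `M` lies in the finitely generated
module of fields with coefficients in `W` and has the same values at `0`; Nakayama's lemma gives
equality (`starModule_valueSubmodule`). -/

/-- Formal power series with coefficients in `M`, as a module over the formal power series. -/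
def Ser (ι M : Type*) := (ι →₀ ℕ) → M

namespace Ser

variable {ι M N P Q : Type*} [AddCommGroup M] [Module ℝ M] [AddCommGroup N] [Module ℝ N]
  [AddCommGroup P] [Module ℝ P] [AddCommGroup Q] [Module ℝ Q]

instance : AddCommGroup (Ser ι M) := inferInstanceAs (AddCommGroup ((ι →₀ ℕ) → M))

instance : Module ℝ (Ser ι M) := inferInstanceAs (Module ℝ ((ι →₀ ℕ) → M))

/-- The coefficient at a monomial. -/
def coeff (m : ι →₀ ℕ) : Ser ι M →ₗ[ℝ] M where
  toFun s := s m
  map_add' _ _ := rfl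
  map_smul' _ _ := rfl

/-- The series with given coefficients. -/
def mk (f : (ι →₀ ℕ) → M) : Ser ι M := f

@[simp] theorem coeff_mk (f : (ι →₀ ℕ) → M) (m : ι →₀ ℕ) : coeff m (mk f) = f m := rfl

@[ext] theorem ext {s t : Ser ι M} (h : ∀ m, coeff m s = coeff m t) : s = t := funext h

/-- A scalar power series, as a series with coefficients in `ℝ`. -/
def ofFPS (f : FPS ι) : Ser ι ℝ := f

@[simp] theorem coeff_ofFPS (f : FPS ι) (m : ι →₀ ℕ) :
    coeff m (ofFPS f) = MvPowerSeries.coeff m f := rfl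

open Classical in
/-- The Cauchy product along a bilinear map. -/
def conv (B : M →ₗ[ℝ] N →ₗ[ℝ] P) (s : Ser ι M) (t : Ser ι N) : Ser ι P :=
  mk fun m => ∑ p ∈ antidiagonal m, B (coeff p.1 s) (coeff p.2 t)

-- Four compatible bilinear maps are allowed, so that this one reindexing yields both the
-- associativity of the scalar action and the linearity of `bil` in each argument.
open Classical in
theorem conv_assoc {R S : Type*} [AddCommGroup R] [Module ℝ R] [AddCommGroup S] [Module ℝ S]
    (B₁ : P →ₗ[ℝ] Q →ₗ[ℝ] R) (B₂ : M →ₗ[ℝ] N →ₗ[ℝ] P) (B₃ : M →ₗ[ℝ] S →ₗ[ℝ] R)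
    (B₄ : N →ₗ[ℝ] Q →ₗ[ℝ] S) (h : ∀ x y z, B₁ (B₂ x y) z = B₃ x (B₄ y z))
    (s : Ser ι M) (t : Ser ι N) (u : Ser ι Q) :
    conv B₁ (conv B₂ s t) u = conv B₃ s (conv B₄ t u) := by
  ext m
  simp only [conv, coeff_mk, map_sum, LinearMap.sum_apply, Finset.sum_sigma']
  apply Finset.sum_nbij' (fun ⟨⟨_i, j⟩, ⟨k, l⟩⟩ ↦ ⟨(k, l + j), (l, j)⟩)
    (fun ⟨⟨i, _j⟩, ⟨k, l⟩⟩ ↦ ⟨(i + k, l), (i, k)⟩) <;> simp <;> grind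

open Classical in
theorem conv_flip (B : M →ₗ[ℝ] N →ₗ[ℝ] P) (s : Ser ι M) (t : Ser ι N) :
    conv B.flip t s = conv B s t := by
  ext m
  exact (Finsupp.sum_antidiagonal_swap m fun a b => B (coeff a s) (coeff b t)).symm

theorem conv_add_left (B : M →ₗ[ℝ] N →ₗ[ℝ] P) (s s' : Ser ι M) (t : Ser ι N) :
    conv B (s + s') t = conv B s t + conv B s' t := by
  ext m; simp [conv, Finset.sum_add_distrib]

theorem conv_add_right (B : M →ₗ[ℝ] N →ₗ[ℝ] P) (s : Ser ι M) (t t' : Ser ι N) :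
    conv B s (t + t') = conv B s t + conv B s t' := by
  ext m; simp [conv, Finset.sum_add_distrib]

/-! ### Module structure over the scalar power series -/

instance : SMul (FPS ι) (Ser ι M) where
  smul f s := conv (LinearMap.lsmul ℝ M) (ofFPS f) s

theorem smul_def (f : FPS ι) (s : Ser ι M) :
    f • s = conv (LinearMap.lsmul ℝ M) (ofFPS f) s := rfl

open Classical in
theorem coeff_smul (f : FPS ι) (s : Ser ι M) (m : ι →₀ ℕ) :
    coeff m (f • s) = ∑ p ∈ antidiagonal m, MvPowerSeries.coeff p.1 f • coeff p.2 s := rfl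

theorem ofFPS_mul (f g : FPS ι) :
    ofFPS (f * g) = conv (LinearMap.lsmul ℝ ℝ) (ofFPS f) (ofFPS g) := by
  classical
  ext m
  rw [coeff_ofFPS, MvPowerSeries.coeff_mul]
  change _ = ∑ p ∈ _, _
  refine Finset.sum_congr ?_ fun _ _ => rfl
  congr

open Classical in
theorem coeff_monomial_smul (a m : ι →₀ ℕ) (c : ℝ) (s : Ser ι M) :
    coeff m (MvPowerSeries.monomial a c • s : Ser ι M) =
      if a ≤ m then c • coeff (m - a) s else 0 := by
  rw [coeff_smul]
  split_ifs with h
  · rw [Finset.sum_eq_single (a, m - a)]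
    · rw [MvPowerSeries.coeff_monomial_same]
    · rintro ⟨x, y⟩ hx hne
      rw [MvPowerSeries.coeff_monomial_ne, zero_smul]
      rintro rfl
      apply hne
      rw [mem_antidiagonal] at hx
      simp [← hx]
    · intro hn
      exact absurd (mem_antidiagonal.2 (add_tsub_cancel_of_le h)) hn
  · refine Finset.sum_eq_zero ?_
    rintro ⟨x, y⟩ hx
    rw [MvPowerSeries.coeff_monomial_ne, zero_smul]
    rintro rfl
    rw [mem_antidiagonal] at hx
    exact h (hx ▸ le_self_add)

theorem C_smul (c : ℝ) (s : Ser ι M) : (MvPowerSeries.C c : FPS ι) • s = c • s := by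
  ext m
  rw [← MvPowerSeries.monomial_zero_eq_C_apply, coeff_monomial_smul]
  simp

instance : Module (FPS ι) (Ser ι M) where
  one_smul s := by
    have := C_smul 1 s
    rwa [map_one, one_smul] at this
  mul_smul f g s := by
    rw [smul_def, ofFPS_mul]
    exact conv_assoc _ _ _ _ (fun x y z => by simp [mul_smul, smul_comm x y]) _ _ _
  smul_zero f := by ext m; rw [coeff_smul]; simp
  smul_add f s t := conv_add_right _ _ _ _
  add_smul f g s := conv_add_left _ _ _ _
  zero_smul s := by ext m; rw [coeff_smul]; simp

instance : IsScalarTower ℝ (FPS ι) (Ser ι M) where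
  smul_assoc c f s := by
    rw [MvPowerSeries.smul_eq_C_mul, mul_smul, C_smul]

open Classical in
theorem coeff_X_smul (i : ι) (m : ι →₀ ℕ) (s : Ser ι M) :
    coeff m ((MvPowerSeries.X i : FPS ι) • s) =
      if m i = 0 then 0 else coeff (m - Finsupp.single i 1) s := by
  rw [MvPowerSeries.X, coeff_monomial_smul, one_smul]
  have : Finsupp.single i 1 ≤ m ↔ ¬ m i = 0 := by
    rw [Finsupp.single_le_iff]; omega
  by_cases h : m i = 0 <;> simp [this, h]

theorem X_smul_injective (i : ι) {s t : Ser ι M}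
    (h : (MvPowerSeries.X i : FPS ι) • s = (MvPowerSeries.X i : FPS ι) • t) : s = t := by
  ext m
  have := congrArg (coeff (m + Finsupp.single i 1)) h
  rw [coeff_X_smul, coeff_X_smul] at this
  simpa using this

/-- Apply a linear map to all coefficients. -/
def map (f : M →ₗ[ℝ] N) : Ser ι M →ₗ[FPS ι] Ser ι N where
  toFun s := mk fun m => f (coeff m s)
  map_add' s t := by ext m; simp
  map_smul' a s := by
    ext m
    simp only [coeff_mk, coeff_smul, map_sum, map_smul, RingHom.id_apply]

@[simp] theorem coeff_map (f : M →ₗ[ℝ] N) (s : Ser ι M) (m : ι →₀ ℕ) :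
    coeff m (map f s) = f (coeff m s) := rfl

/-- The Cauchy product along a bilinear map, as a bilinear map over the formal power series. -/
def bil (B : M →ₗ[ℝ] N →ₗ[ℝ] P) : Ser ι M →ₗ[FPS ι] Ser ι N →ₗ[FPS ι] Ser ι P :=
  LinearMap.mk₂ (FPS ι) (conv B) (conv_add_left B)
    (fun a s t => conv_assoc _ _ _ _ (fun x y z => by simp) _ _ _)
    (conv_add_right B)
    (fun a s t => by
      rw [smul_def, ← conv_flip B, smul_def, ← conv_flip B]
      exact conv_assoc _ _ _ _ (fun x y z => by simp) _ _ _)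

open Classical in
theorem coeff_bil (B : M →ₗ[ℝ] N →ₗ[ℝ] P) (s : Ser ι M) (t : Ser ι N) (m : ι →₀ ℕ) :
    coeff m (bil B s t) = ∑ p ∈ antidiagonal m, B (coeff p.1 s) (coeff p.2 t) := rfl

open Classical in
/-- The constant series. -/
def const : M →ₗ[ℝ] Ser ι M where
  toFun x := mk fun m => if m = 0 then x else 0
  map_add' x y := by ext m; by_cases h : m = 0 <;> simp [h]
  map_smul' c x := by ext m; by_cases h : m = 0 <;> simp [h]

open Classical in
theorem coeff_const (x : M) (m : ι →₀ ℕ) :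
    coeff m (const x : Ser ι M) = if m = 0 then x else 0 := rfl

@[simp] theorem coeff_zero_const (x : M) : coeff 0 (const x : Ser ι M) = x := by simp [coeff_const]

theorem coeff_const_of_ne (x : M) {m : ι →₀ ℕ} (h : m ≠ 0) : coeff m (const x : Ser ι M) = 0 := by
  simp [coeff_const, h]

theorem coeff_smul_const (f : FPS ι) (x : M) (m : ι →₀ ℕ) :
    coeff m (f • const x : Ser ι M) = MvPowerSeries.coeff m f • x := by
  classical
  rw [coeff_smul, Finset.sum_eq_single (m, 0)]
  · simp
  · rintro ⟨a, b⟩ h hne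
    rw [coeff_const_of_ne, smul_zero]
    rintro rfl
    simp only [mem_antidiagonal, add_zero] at h
    exact hne (by rw [h])
  · simp

@[simp] theorem map_const (f : M →ₗ[ℝ] N) (x : M) : map f (const x : Ser ι M) = const (f x) := by
  classical
  ext m
  rw [coeff_map, coeff_const, coeff_const]
  split_ifs <;> simp

/-! ### Weights, the Euler operator and partial derivatives -/

/-- Multiplication of the coefficient at `m` by `χ m`. -/
def wt (χ : (ι →₀ ℕ) →+ ℕ) : Ser ι M →+ Ser ι M where
  toFun s := mk fun m => χ m • coeff m s
  map_zero' := by ext m; simp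
  map_add' s t := by ext m; simp

@[simp] theorem coeff_wt (χ : (ι →₀ ℕ) →+ ℕ) (s : Ser ι M) (m : ι →₀ ℕ) :
    coeff m (wt χ s) = χ m • coeff m s := rfl

theorem wt_bil (χ : (ι →₀ ℕ) →+ ℕ) (B : M →ₗ[ℝ] N →ₗ[ℝ] P) (s : Ser ι M) (t : Ser ι N) :
    wt χ (bil B s t) = bil B (wt χ s) t + bil B s (wt χ t) := by
  classical
  ext m
  rw [coeff_wt, map_add, coeff_bil, coeff_bil, coeff_bil, Finset.smul_sum,
    ← Finset.sum_add_distrib]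
  refine Finset.sum_congr rfl fun p hp => ?_
  rw [← mem_antidiagonal.1 hp, map_add, add_smul]
  simp

/-- The Euler operator. -/
def euler : Ser ι M →+ Ser ι M := wt Finsupp.degree

@[simp] theorem coeff_euler (s : Ser ι M) (m : ι →₀ ℕ) :
    coeff m (euler s) = m.degree • coeff m s := rfl

/-- Partial derivatives. -/
def pd (i : ι) : Ser ι M →+ Ser ι M where
  toFun s := mk fun m => (m i + 1) • coeff (m + Finsupp.single i 1) s
  map_zero' := by ext m; simp
  map_add' s t := by ext m; simp only [coeff_mk, map_add, smul_add]

@[simp] theorem coeff_pd (i : ι) (s : Ser ι M) (m : ι →₀ ℕ) :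
    coeff m (pd i s) = (m i + 1) • coeff (m + Finsupp.single i 1) s := rfl

theorem X_smul_pd (i : ι) (s : Ser ι M) :
    (MvPowerSeries.X i : FPS ι) • pd i s = wt (Finsupp.applyAddHom i) s := by
  classical
  ext m
  rw [coeff_X_smul, coeff_wt, Finsupp.applyAddHom_apply, coeff_pd]
  split_ifs with h
  · simp [h]
  · have : m - Finsupp.single i 1 + Finsupp.single i 1 = m :=
      tsub_add_cancel_of_le (by rw [Finsupp.single_le_iff]; omega)
    rw [this]
    congr 1
    simp
    omega

/-- After multiplication by `t_i`, which is injective, `∂_i` becomes the weight `m ↦ m i`, and the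
Leibniz rule becomes additivity of that weight. -/
theorem pd_bil (i : ι) (B : M →ₗ[ℝ] N →ₗ[ℝ] P) (s : Ser ι M) (t : Ser ι N) :
    pd i (bil B s t) = bil B (pd i s) t + bil B s (pd i t) := by
  apply X_smul_injective i
  rw [X_smul_pd, wt_bil, smul_add, ← LinearMap.smul_apply, ← map_smul (bil B),
    ← map_smul (bil B s), X_smul_pd, X_smul_pd]

theorem pd_ofFPS (i : ι) (f : FPS ι) : pd i (ofFPS f) = ofFPS (MvPowerSeries.pderiv ℝ i f) := by
  ext m
  rw [coeff_ofFPS, MvPowerSeries.coeff_pderiv, coeff_pd, coeff_ofFPS, nsmul_eq_mul]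
  push_cast
  ring

theorem pd_smul (i : ι) (f : FPS ι) (s : Ser ι M) :
    pd i (f • s) = MvPowerSeries.pderiv ℝ i f • s + f • pd i s := by
  have := pd_bil i (LinearMap.lsmul ℝ M) (ofFPS f) s
  rw [pd_ofFPS] at this
  exact this

@[simp] theorem pd_const (i : ι) (x : M) : pd i (const x : Ser ι M) = 0 := by
  ext m
  rw [coeff_pd, coeff_const_of_ne, smul_zero, map_zero]
  intro h
  simpa using DFunLike.congr_fun h i

@[simp] theorem pd_map (i : ι) (f : M →ₗ[ℝ] N) (s : Ser ι M) : pd i (map f s) = map f (pd i s) := by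
  ext m
  simp only [coeff_pd, coeff_map, map_nsmul]

/-- `∂_i` lowers the degree by one. The extra term is what raises the shift `n` in `euler_add_pd`.
-/
theorem pd_euler (i : ι) (s : Ser ι M) : pd i (euler s) = euler (pd i s) + pd i s := by
  ext m
  simp only [coeff_pd, coeff_euler, map_add, Finsupp.degree_single]
  rw [smul_comm, ← succ_nsmul]

end Ser

/-! ### The Lie product of series and the operator `ad v` -/

namespace Ser

variable {ι g : Type*} [LieRing g] [LieAlgebra ℝ g]

/-- The adjoint action as a linear map. -/
def adL (x : g) : g →ₗ[ℝ] g := LieAlgebra.ad ℝ g x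

@[simp] theorem adL_apply (x y : g) : adL x y = ⁅x, y⁆ := rfl

/-- The Lie product of series. -/
def lie : Ser ι g →ₗ[FPS ι] Ser ι g →ₗ[FPS ι] Ser ι g :=
  bil (LieAlgebra.ad ℝ g : g →ₗ[ℝ] g →ₗ[ℝ] g)

open Classical in
theorem coeff_lie (s t : Ser ι g) (m : ι →₀ ℕ) :
    coeff m (lie s t) = ∑ p ∈ antidiagonal m, ⁅coeff p.1 s, coeff p.2 t⁆ := rfl

theorem lie_skew (s t : Ser ι g) : lie s t = -lie t s := by
  classical
  ext m
  rw [map_neg, coeff_lie, coeff_lie, ← Finset.sum_neg_distrib,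
    Finsupp.sum_antidiagonal_swap m fun a b => ⁅coeff a s, coeff b t⁆]
  exact Finset.sum_congr rfl fun p _ => (_root_.lie_skew _ _).symm

theorem euler_lie (s t : Ser ι g) : euler (lie s t) = lie (euler s) t + lie s (euler t) :=
  wt_bil _ _ s t

theorem map_adL_lie (x : g) (s t : Ser ι g) :
    map (adL x) (lie s t) = lie (map (adL x) s) t + lie s (map (adL x) t) := by
  classical
  ext m
  rw [map_add, coeff_map, coeff_lie, coeff_lie, coeff_lie, map_sum, ← Finset.sum_add_distrib]
  exact Finset.sum_congr rfl fun p _ => leibniz_lie _ _ _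

theorem const_lie (x : g) (t : Ser ι g) : lie (const x) t = map (adL x) t := by
  classical
  ext m
  rw [coeff_lie, Finset.sum_eq_single (0, m)]
  · simp
  · rintro ⟨a, b⟩ h hne
    rw [coeff_const_of_ne, zero_lie]
    rintro rfl
    rw [mem_antidiagonal] at h
    exact hne (by simpa using h)
  · simp

theorem mk_constSeries (x : g) : mk (constSeries ι x) = const x := by
  classical
  ext m
  rw [coeff_const, coeff_mk]
  simp [constSeries, Pi.single_apply]

theorem degree_tsub_single {m : ι →₀ ℕ} {i : ι} (h : m i ≠ 0) :
    (m - Finsupp.single i 1).degree + 1 = m.degree := by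
  have : m - Finsupp.single i 1 + Finsupp.single i 1 = m :=
    tsub_add_cancel_of_le (by rw [Finsupp.single_le_iff]; omega)
  conv_rhs => rw [← this, map_add, Finsupp.degree_single]

theorem eq_zero_of_coeff {s : Ser ι g}
    (h : ∀ m : ι →₀ ℕ, (∀ n : ι →₀ ℕ, n.degree < m.degree → coeff n s = 0) → coeff m s = 0) :
    s = 0 := by
  have key : ∀ d : ℕ, ∀ m : ι →₀ ℕ, m.degree = d → coeff m s = 0 := by
    intro d
    induction d using Nat.strong_induction_on with
    | _ d ih => exact fun m hm => h m fun n hn => ih n.degree (by omega) n rfl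
  ext m
  rw [key _ m rfl, map_zero]

variable [Fintype ι] (e : ι → g)

/-- The operator `ad v` at the generic point `v = ∑ i, t i • e i`. -/
def adv : Ser ι g →ₗ[FPS ι] Ser ι g := ∑ i, (MvPowerSeries.X i : FPS ι) • map (adL (e i))

theorem adv_apply (s : Ser ι g) :
    adv e s = ∑ i, (MvPowerSeries.X i : FPS ι) • map (adL (e i)) s := by
  simp [adv, LinearMap.sum_apply]

theorem adv_lie (s t : Ser ι g) : adv e (lie s t) = lie (adv e s) t + lie s (adv e t) := by
  simp only [adv_apply, map_adL_lie, map_sum, LinearMap.sum_apply, smul_add, map_smul,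
    LinearMap.smul_apply, Finset.sum_add_distrib]

theorem pd_adv (i : ι) (s : Ser ι g) :
    pd i (adv e s) = adv e (pd i s) + map (adL (e i)) s := by
  classical
  rw [adv_apply, adv_apply, map_sum]
  simp only [pd_smul, pd_map, MvPowerSeries.pderiv_X, Finset.sum_add_distrib, Pi.single_apply,
    ite_smul, one_smul, zero_smul]
  rw [add_comm]
  simp

open Classical in
theorem coeff_adv (s : Ser ι g) (m : ι →₀ ℕ) :
    coeff m (adv e s) =
      ∑ i, if m i = 0 then 0 else ⁅e i, coeff (m - Finsupp.single i 1) s⁆ := by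
  rw [adv_apply, map_sum]
  exact Finset.sum_congr rfl fun i _ => by rw [coeff_X_smul]; rfl

theorem mk_adGen (f : (ι →₀ ℕ) → g) : mk (adGen e f) = adv e (mk f) := by
  classical
  ext m
  rw [coeff_adv, coeff_mk]
  change ∑ i ∈ m.support, ⁅e i, f (m - Finsupp.single i 1)⁆ = _
  rw [← Finset.sum_subset (Finset.subset_univ m.support)]
  · refine Finset.sum_congr rfl fun i hi => ?_
    rw [if_neg (Finsupp.mem_support_iff.1 hi), coeff_mk]
  · intro i _ hi
    rw [if_pos (Finsupp.notMem_support_iff.1 hi)]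

theorem mk_adGen_pow (h : ℕ) (f : (ι →₀ ℕ) → g) :
    mk ((adGen e ^ h) f) = (adv e ^ h) (mk f) := by
  induction h generalizing f with
  | zero => rfl
  | succ h ih => rw [pow_succ, pow_succ, Module.End.mul_apply, Module.End.mul_apply, ih, mk_adGen]

variable {e}

theorem coeff_adv_eq_zero {s : Ser ι g} {m : ι →₀ ℕ}
    (h : ∀ n : ι →₀ ℕ, n.degree + 1 = m.degree → coeff n s = 0) : coeff m (adv e s) = 0 := by
  classical
  rw [coeff_adv]
  refine Finset.sum_eq_zero fun i _ => ?_
  split_ifs with hi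
  · rfl
  · rw [h _ (degree_tsub_single hi), lie_zero]

/-- `ad v` raises degrees by exactly one, so a coefficient of `(ad v)^r s` depends only on the
coefficients of `s` that are `r` degrees lower. -/
theorem coeff_adv_pow_eq_zero (r : ℕ) {s : Ser ι g} {m : ι →₀ ℕ}
    (h : ∀ n : ι →₀ ℕ, n.degree + r = m.degree → coeff n s = 0) :
    coeff m ((adv e ^ r) s) = 0 := by
  induction r generalizing m with
  | zero => exact h m rfl
  | succ r ih =>
    rw [pow_succ', Module.End.mul_apply]
    exact coeff_adv_eq_zero fun n hn => ih fun n' hn' => h n' (by omega)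

theorem coeff_adv_pow_congr (r : ℕ) {s t : Ser ι g} {m : ι →₀ ℕ}
    (h : ∀ n : ι →₀ ℕ, n.degree + r = m.degree → coeff n s = coeff n t) :
    coeff m ((adv e ^ r) s) = coeff m ((adv e ^ r) t) := by
  rw [← sub_eq_zero, ← map_sub, ← map_sub]
  exact coeff_adv_pow_eq_zero r fun n hn => by rw [map_sub, h n hn, sub_self]

theorem coeff_adv_pow_of_lt {r : ℕ} (s : Ser ι g) {m : ι →₀ ℕ} (h : m.degree < r) :
    coeff m ((adv e ^ r) s) = 0 :=
  coeff_adv_pow_eq_zero r fun n hn => by omega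

/-! ### The equation `(E + n + ad v) s = 0` and the series `p (ad v) x` -/

variable (e)

/-- The equation `(euler + n + ad v) s = 0` has only the trivial solution if `n > 0`. -/
theorem eq_zero_of_euler_add {n : ℕ} (hn : n ≠ 0) {s : Ser ι g}
    (h : euler s + n • s + adv e s = 0) : s = 0 := by
  have key : ∀ d : ℕ, ∀ m : ι →₀ ℕ, m.degree = d → coeff m s = 0 := by
    intro d
    induction d using Nat.strong_induction_on with
    | _ d ih =>
      intro m hm
      have h1 := congrArg (coeff m) h
      -- At `m` the equation reads `(|m| + n) s_m` plus terms of degree `|m| - 1`; the latter vanish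
      -- by induction, and `|m| + n` is nonzero.
      rw [map_add, map_add, coeff_euler, map_nsmul, map_zero,
        coeff_adv_eq_zero (fun n' hn' => ih n'.degree (by omega) n' rfl), add_zero,
        ← add_smul, ← Nat.cast_smul_eq_nsmul ℝ] at h1
      exact (smul_eq_zero.1 h1).resolve_left (by exact_mod_cast (by omega))
  ext m
  rw [key _ m rfl, map_zero]

/-- The series `∑ p_h (ad v)^h x`. -/
def expand (p : ℕ → ℝ) (x : g) : Ser ι g :=
  mk fun m => p m.degree • coeff m ((adv e ^ m.degree) (const x))

theorem coeff_expand (p : ℕ → ℝ) (x : g) (m : ι →₀ ℕ) :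
    coeff m (expand e p x) = p m.degree • coeff m ((adv e ^ m.degree) (const x)) := rfl

theorem coeff_adv_pow_expand (p : ℕ → ℝ) (x : g) (r : ℕ) (m : ι →₀ ℕ) (h : r ≤ m.degree) :
    coeff m ((adv e ^ r) (expand e p x)) =
      p (m.degree - r) • coeff m ((adv e ^ m.degree) (const x)) := by
  have h1 := coeff_adv_pow_congr (e := e) r (s := expand e p x)
    (t := p (m.degree - r) • (adv e ^ (m.degree - r)) (const x)) (m := m) (fun n hn => by
      have : m.degree - r = n.degree := by omega
      rw [coeff_expand, this, map_smul])
  rw [h1, ← C_smul, map_smul, C_smul, map_smul, ← Module.End.mul_apply, ← pow_add,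
    Nat.add_sub_cancel' h]

/-- `(ad v)^h x` is homogeneous of degree `h`: the Euler operator multiplies it by `h` and `ad v`
moves it to the next degree. The equation is thus a recursion on the coefficients. -/
theorem euler_add_expand {p q : ℕ → ℝ} {n : ℕ} (x : g)
    (h0 : n * p 0 = q 0) (h : ∀ d : ℕ, (d + 1 + n) * p (d + 1) + p d = q (d + 1)) :
    euler (expand e p x) + n • expand e p x + adv e (expand e p x) = expand e q x := by
  ext m
  rw [map_add, map_add, coeff_euler, map_nsmul, coeff_expand, coeff_expand, ← Nat.cast_smul_eq_nsmul ℝ,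
    ← Nat.cast_smul_eq_nsmul ℝ, smul_smul, smul_smul, ← add_smul]
  rcases Nat.eq_zero_or_pos m.degree with hm | hm
  · rw [coeff_adv_eq_zero (fun n' hn' => by omega), hm, ← h0]
    simp
  · obtain ⟨d, hd⟩ := Nat.exists_eq_succ_of_ne_zero hm.ne'
    have h1 := coeff_adv_pow_expand e p x 1 m (by omega)
    rw [pow_one] at h1
    rw [h1, ← add_smul, hd, ← h d]
    congr 1
    push_cast
    simp
    ring

theorem expand_eq_const {q : ℕ → ℝ} (h0 : q 0 = 1) (h : ∀ d, q (d + 1) = 0) (x : g) :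
    expand e q x = const x := by
  ext m
  rw [coeff_expand]
  rcases Nat.eq_zero_or_pos m.degree with hm | hm
  · rw [hm, h0, one_smul]; rfl
  · obtain ⟨d, hd⟩ := Nat.exists_eq_succ_of_ne_zero hm.ne'
    rw [hd, h, zero_smul, coeff_const_of_ne]
    rintro rfl
    simp at hm

/-! ### Power series in `ad v` -/

theorem sum_adv_pow_eq (b : ℕ → ℝ) (s : Ser ι g) {m : ι →₀ ℕ} {n : ℕ} (h : m.degree < n) :
    ∑ r ∈ Finset.range (m.degree + 1), b r • coeff m ((adv e ^ r) s) =
      ∑ r ∈ Finset.range n, b r • coeff m ((adv e ^ r) s) := by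
  refine Finset.sum_subset (fun r hr => ?_) fun r _ hr => ?_
  · rw [Finset.mem_range] at hr ⊢; omega
  · rw [Finset.mem_range] at hr
    rw [coeff_adv_pow_of_lt s (by omega), smul_zero]

/-- The operator `∑ b_r (ad v)^r`. -/
def advSeries (b : ℕ → ℝ) : Ser ι g →ₗ[FPS ι] Ser ι g where
  toFun s := mk fun m => ∑ r ∈ Finset.range (m.degree + 1), b r • coeff m ((adv e ^ r) s)
  map_add' s t := by ext m; simp [Finset.sum_add_distrib]
  map_smul' f s := by
    classical
    ext m
    simp only [coeff_mk, map_smul, RingHom.id_apply, coeff_smul, Finset.smul_sum]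
    rw [Finset.sum_comm]
    refine Finset.sum_congr rfl fun p hp => ?_
    have hd : p.2.degree < m.degree + 1 := by
      rw [← mem_antidiagonal.1 hp, map_add]; omega
    -- The truncation of the sum depends on the degree of the monomial; lengthening it adds only
    -- zero terms, so all the inner sums can be given the same range.
    rw [← Finset.smul_sum, sum_adv_pow_eq e b s hd, Finset.smul_sum]
    exact Finset.sum_congr rfl fun r _ => smul_comm _ _ _

theorem coeff_advSeries (b : ℕ → ℝ) (s : Ser ι g) (m : ι →₀ ℕ) :
    coeff m (advSeries e b s) =
      ∑ r ∈ Finset.range (m.degree + 1), b r • coeff m ((adv e ^ r) s) := rfl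

/-- Power series in the single operator `ad v` compose by the Cauchy product of their coefficients.
-/
theorem advSeries_expand (b p q : ℕ → ℝ) (x : g)
    (h : ∀ n, ∑ r ∈ Finset.range (n + 1), b r * p (n - r) = q n) :
    advSeries e b (expand e p x) = expand e q x := by
  ext m
  rw [coeff_advSeries, coeff_expand, ← h, Finset.sum_smul]
  refine Finset.sum_congr rfl fun r hr => ?_
  rw [Finset.mem_range] at hr
  rw [coeff_adv_pow_expand e p x r m (by omega), smul_smul]

theorem coeff_advSeries_of_lower {b : ℕ → ℝ} (hb : b 0 = 1) {s : Ser ι g} {m : ι →₀ ℕ}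
    (h : ∀ n : ι →₀ ℕ, n.degree < m.degree → coeff n s = 0) :
    coeff m (advSeries e b s) = coeff m s := by
  rw [coeff_advSeries, Finset.sum_eq_single 0]
  · rw [hb, one_smul]; rfl
  · intro r _ hr
    rw [coeff_adv_pow_eq_zero r fun n hn => h n (by omega), smul_zero]
  · simp

/-- With leading coefficient `1`, the operator leaves the lowest-degree coefficients of a series
unchanged. -/
theorem advSeries_injective {b : ℕ → ℝ} (hb : b 0 = 1) :
    Function.Injective (advSeries (ι := ι) e b) := by
  rw [injective_iff_map_eq_zero]
  intro s hs
  refine eq_zero_of_coeff fun m hm => ?_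
  rw [← coeff_advSeries_of_lower e hb hm, hs, map_zero]

end Ser

/-! ### The coefficients -/

theorem bCoeff_zero : bCoeff 0 = 1 := by simp [bCoeff]

/-- The coefficients of `(1 - exp (-t)) / t`. -/
def mcCoeff (h : ℕ) : ℝ := (-1) ^ h / (h + 1).factorial

/-- The coefficients of `exp (-t)`. -/
def expNegCoeff (h : ℕ) : ℝ := (-1) ^ h / h.factorial

/-- Coefficient form of `t f' + f + t f = 1` for `f = (1 - exp (-t)) / t`, which follows from `(t
f)' = exp (-t)`. -/
theorem mcCoeff_rec (d : ℕ) : ((d : ℝ) + 1 + (1 : ℕ)) * mcCoeff (d + 1) + mcCoeff d = 0 := by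
  have h1 : ((d + 1).factorial : ℝ) ≠ 0 := by positivity
  have h2 : ((d : ℝ) + 1 + 1) ≠ 0 := by positivity
  rw [mcCoeff, mcCoeff, Nat.factorial_succ (d + 1)]
  push_cast
  field_simp
  ring

theorem expNegCoeff_rec (d : ℕ) :
    ((d : ℝ) + 1 + (0 : ℕ)) * expNegCoeff (d + 1) + expNegCoeff d = 0 := by
  have h1 : (d.factorial : ℝ) ≠ 0 := by positivity
  have h2 : ((d : ℝ) + 1) ≠ 0 := by positivity
  rw [expNegCoeff, expNegCoeff, Nat.factorial_succ d]
  push_cast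
  field_simp
  ring

theorem evalNegHom_exp : PowerSeries.evalNegHom (PowerSeries.exp ℝ) = PowerSeries.mk expNegCoeff := by
  ext n
  simp [PowerSeries.evalNegHom, PowerSeries.coeff_rescale, expNegCoeff, PowerSeries.coeff_exp]
  rfl

theorem one_sub_evalNegHom_exp :
    1 - PowerSeries.evalNegHom (PowerSeries.exp ℝ) = PowerSeries.X * PowerSeries.mk mcCoeff := by
  rw [evalNegHom_exp]
  ext n
  cases n with
  | zero => simp [expNegCoeff]
  | succ n =>
    rw [PowerSeries.coeff_succ_X_mul]
    simp [expNegCoeff, mcCoeff, PowerSeries.coeff_one, pow_succ]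
    ring

theorem mk_bCoeff_mul_mk_mcCoeff : PowerSeries.mk bCoeff * PowerSeries.mk mcCoeff = 1 := by
  have h := bCoeff_generating
  rw [one_sub_evalNegHom_exp] at h
  have hX : (PowerSeries.X : PowerSeries ℝ) ≠ 0 := PowerSeries.X_ne_zero
  refine mul_left_cancel₀ hX ?_
  linear_combination h

/-- The product is `t / (1 - exp (-t)) - t`. Subtracting `t` turns `b_1 = 1/2` into `-1/2`, and the
other `b_h` of odd index vanish, so the result is the sign-alternated series. -/
theorem mk_bCoeff_mul_mk_expNegCoeff :
    PowerSeries.mk bCoeff * PowerSeries.mk expNegCoeff =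
      PowerSeries.mk fun h => (-1) ^ h * bCoeff h := by
  have h := bCoeff_generating
  rw [evalNegHom_exp] at h
  have h1 : (PowerSeries.mk fun h => (-1) ^ h * bCoeff h) = PowerSeries.mk bCoeff - PowerSeries.X := by
    ext n
    rw [map_sub, PowerSeries.coeff_mk, PowerSeries.coeff_mk, PowerSeries.coeff_X]
    split_ifs with hn
    · subst hn
      simp [bCoeff]
      norm_num
    · have := bernoulli_eq_bernoulli'_of_ne_one hn
      rw [bernoulli] at this
      rw [sub_zero, bCoeff]
      conv_rhs => rw [← this]
      push_cast
      ring
  rw [h1]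
  linear_combination -h

theorem coeff_mk_mul_mk (b p : ℕ → ℝ) (n : ℕ) :
    PowerSeries.coeff n (PowerSeries.mk b * PowerSeries.mk p) =
      ∑ r ∈ Finset.range (n + 1), b r * p (n - r) := by
  rw [PowerSeries.coeff_mul, Finset.Nat.sum_antidiagonal_eq_sum_range_succ_mk]
  simp

theorem sum_bCoeff_mul_mcCoeff (n : ℕ) :
    ∑ r ∈ Finset.range (n + 1), bCoeff r * mcCoeff (n - r) = if n = 0 then 1 else 0 := by
  rw [← coeff_mk_mul_mk, mk_bCoeff_mul_mk_mcCoeff, PowerSeries.coeff_one]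

theorem sum_bCoeff_mul_expNegCoeff (n : ℕ) :
    ∑ r ∈ Finset.range (n + 1), bCoeff r * expNegCoeff (n - r) = (-1) ^ n * bCoeff n := by
  rw [← coeff_mk_mul_mk, mk_bCoeff_mul_mk_expNegCoeff, PowerSeries.coeff_mk]

/-! ### Derivations of the ring of formal power series -/

section Derivations

theorem derivation_sum_apply {ι κ : Type*} (S : Finset κ) (D : κ → Der ι) (f : FPS ι) :
    (∑ k ∈ S, D k) f = ∑ k ∈ S, D k f :=
  map_sum ({ toFun := fun D => D f, map_zero' := rfl, map_add' := fun _ _ => rfl } : Der ι →+ FPS ι)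
    D S

variable {ι : Type*} [Fintype ι]

/-- Euler's identity: dividing each coefficient by its degree gives `u` with `∑ t_j ∂_j u = f -
f(0)`. -/
theorem exists_eq_C_add_sum_X_mul (f : FPS ι) :
    ∃ h : ι → FPS ι, f = MvPowerSeries.C (MvPowerSeries.constantCoeff f) +
      ∑ j, MvPowerSeries.X j * h j := by
  classical
  let u : Ser ι ℝ := Ser.mk fun m => (m.degree : ℝ)⁻¹ * MvPowerSeries.coeff m f
  let w : ι → FPS ι := fun j => Ser.pd j u
  refine ⟨w, ?_⟩
  refine MvPowerSeries.ext fun m => ?_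
  have h1 : ∀ j, MvPowerSeries.coeff m (MvPowerSeries.X j * w j) =
      m j * ((m.degree : ℝ)⁻¹ * MvPowerSeries.coeff m f) := by
    intro j
    have h2 : Ser.coeff m (Ser.ofFPS (MvPowerSeries.X j * w j)) =
        Ser.coeff m ((MvPowerSeries.X j : FPS ι) • Ser.pd j u) := by
      rw [Ser.ofFPS_mul]; rfl
    rw [Ser.X_smul_pd, Ser.coeff_wt, nsmul_eq_mul] at h2
    exact h2
  rw [map_add, map_sum, Finset.sum_congr rfl fun j _ => h1 j, ← Finset.sum_mul,
    MvPowerSeries.coeff_C]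
  split_ifs with hm
  · simp [hm]
  · have hd : (∑ j, (m j : ℝ)) = m.degree := by
      rw [Finsupp.degree_eq_sum]; push_cast; rfl
    have h0 : (m.degree : ℝ) ≠ 0 := by
      simpa [Finsupp.degree_eq_zero_iff] using hm
    rw [hd, zero_add, mul_inv_cancel_left₀ h0]

/-- No continuity of `D` is needed: writing `f = f(0) + ∑ t_j u_j` gives `D f = ∑ t_j D u_j`, and
iterating puts `D f` in every power of the maximal ideal. -/
theorem derivation_eq_zero {D : Der ι} (h : ∀ j, D (MvPowerSeries.X j) = 0) : D = 0 := by
  classical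
  have key : ∀ n : ℕ, ∀ f : FPS ι, ∀ m : ι →₀ ℕ, m.degree < n →
      MvPowerSeries.coeff m (D f) = 0 := by
    intro n
    induction n with
    | zero => intro f m hm; omega
    | succ n ih =>
      intro f m hm
      obtain ⟨u, hu⟩ := exists_eq_C_add_sum_X_mul f
      have hC : D (MvPowerSeries.C (MvPowerSeries.constantCoeff f)) = 0 :=
        D.map_algebraMap _
      rw [hu, map_add, hC, zero_add, map_sum, map_sum]
      refine Finset.sum_eq_zero fun j _ => ?_
      rw [Derivation.leibniz, h j, smul_zero, add_zero, smul_eq_mul]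
      have h2 : MvPowerSeries.coeff m (MvPowerSeries.X j * D (u j)) =
        Ser.coeff m ((MvPowerSeries.X j : FPS ι) • Ser.ofFPS (D (u j))) := by
          change Ser.coeff m (Ser.ofFPS (MvPowerSeries.X j * D (u j))) = _
          rw [Ser.ofFPS_mul]; rfl
      rw [h2, Ser.coeff_X_smul]
      split_ifs with hj
      · rfl
      · have := Ser.degree_tsub_single hj
        exact ih _ _ (by omega)
  ext f m
  exact key _ f m (Nat.lt_succ_self _)

theorem derivation_ext {D D' : Der ι} (h : ∀ j, D (MvPowerSeries.X j) = D' (MvPowerSeries.X j)) :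
    D = D' := by
  rw [← sub_eq_zero]
  exact derivation_eq_zero fun j => by rw [Derivation.sub_apply, h, sub_self]

theorem sum_smul_pderiv_X (u : ι → FPS ι) (k : ι) :
    (∑ j, u j • MvPowerSeries.pderiv ℝ j : Der ι) (MvPowerSeries.X k) = u k := by
  classical
  rw [derivation_sum_apply]
  simp [MvPowerSeries.pderiv_X, Pi.single_apply]

theorem derivation_apply (D : Der ι) (f : FPS ι) :
    D f = ∑ j, D (MvPowerSeries.X j) * MvPowerSeries.pderiv ℝ j f := by
  have h : D = ∑ j, D (MvPowerSeries.X j) • MvPowerSeries.pderiv ℝ j :=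
    derivation_ext fun k => (sum_smul_pderiv_X (fun j => D (MvPowerSeries.X j)) k).symm
  conv_lhs => rw [h]
  rw [derivation_sum_apply]
  rfl

end Derivations

/-! ### Formal vector fields acting on vector-valued series -/

namespace Ser

variable {ι M N : Type*} [Fintype ι] [AddCommGroup M] [Module ℝ M] [AddCommGroup N] [Module ℝ N]

/-- The action of a formal vector field on series. -/
def act (D : Der ι) : Ser ι M →+ Ser ι M where
  toFun s := ∑ j, D (MvPowerSeries.X j) • pd j s
  map_zero' := by simp
  map_add' s t := by simp [Finset.sum_add_distrib]

theorem act_apply (D : Der ι) (s : Ser ι M) : act D s = ∑ j, D (MvPowerSeries.X j) • pd j s := rfl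

theorem act_smul (D : Der ι) (f : FPS ι) (s : Ser ι M) :
    act D (f • s) = D f • s + f • act D s := by
  rw [act_apply, act_apply, derivation_apply D f, Finset.sum_smul, Finset.smul_sum,
    ← Finset.sum_add_distrib]
  refine Finset.sum_congr rfl fun j _ => ?_
  rw [pd_smul, smul_add, smul_smul, smul_comm f]

theorem act_map (D : Der ι) (f : M →ₗ[ℝ] N) (s : Ser ι M) : act D (map f s) = map f (act D s) := by
  simp [act_apply]

/-! ### The Maurer-Cartan form -/

variable {g : Type*} [LieRing g] [LieAlgebra ℝ g] (e : ι → g)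

/-- The Maurer-Cartan form `∑ (-1)^h / (h+1)! (ad v)^h`, on formal vector fields. -/
def mcForm : Der ι →ₗ[FPS ι] Ser ι g where
  toFun D := ∑ j, D (MvPowerSeries.X j) • expand e mcCoeff (e j)
  map_add' D D' := by simp [add_smul, Finset.sum_add_distrib]
  map_smul' f D := by simp [Finset.smul_sum, mul_smul]

theorem mcForm_apply (D : Der ι) :
    mcForm e D = ∑ j, D (MvPowerSeries.X j) • expand e mcCoeff (e j) := rfl

theorem euler_add_mc (x : g) :
    euler (expand e mcCoeff x) + 1 • expand e mcCoeff x + adv e (expand e mcCoeff x) = const x := by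
  rw [← expand_eq_const e (q := fun n => if n = 0 then 1 else 0) rfl (fun d => rfl) x]
  refine euler_add_expand e x ?_ fun d => ?_
  · simp [mcCoeff]
  · simpa using mcCoeff_rec d

theorem euler_add_expNeg (x : g) :
    euler (expand e expNegCoeff x) + adv e (expand e expNegCoeff x) = 0 := by
  have h := euler_add_expand e (p := expNegCoeff) (q := fun _ => 0) (n := 0) x (by simp)
    (fun d => expNegCoeff_rec d)
  have h0 : expand e (fun _ => 0) x = 0 := by
    ext m; simp [coeff_expand]
  rwa [h0, zero_smul, add_zero] at h

/-- The Euler operator and `ad v` are both derivations of the Lie product, and the shift splits as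
`a + b`. -/
theorem euler_add_lie (a b : ℕ) (s t : Ser ι g) :
    euler (lie s t) + (a + b) • lie s t + adv e (lie s t) =
      lie (euler s + a • s + adv e s) t + lie s (euler t + b • t + adv e t) := by
  rw [euler_lie, adv_lie]
  simp only [map_add, LinearMap.add_apply, map_nsmul, LinearMap.smul_apply, add_smul]
  abel

/-- This combines the commutators `[∂_i, E] = ∂_i` and `[∂_i, ad v] = ad e_i`. -/
theorem euler_add_pd (n : ℕ) (i : ι) (s : Ser ι g) :
    euler (pd i s) + (n + 1) • pd i s + adv e (pd i s) =
      pd i (euler s + n • s + adv e s) - lie (const (e i)) s := by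
  rw [map_add, map_add, pd_euler, pd_adv, map_nsmul, const_lie, add_smul, one_smul]
  abel

/-- Applying `E + 2 + ad v` to the left side leaves brackets of `e_i`, `e_j` with the form, and
these cancel; `eq_zero_of_euler_add` concludes. -/
theorem mc_flat_basis (i j : ι) :
    pd i (expand e mcCoeff (e j)) - pd j (expand e mcCoeff (e i)) +
      lie (expand e mcCoeff (e i)) (expand e mcCoeff (e j)) = 0 := by
  have h1 := euler_add_pd e 1 i (expand e mcCoeff (e j))
  have h2 := euler_add_pd e 1 j (expand e mcCoeff (e i))
  have h3 := euler_add_lie e 1 1 (expand e mcCoeff (e i)) (expand e mcCoeff (e j))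
  rw [euler_add_mc, pd_const] at h1 h2
  rw [euler_add_mc, euler_add_mc, lie_skew _ (const (e j))] at h3
  refine eq_zero_of_euler_add e two_ne_zero ?_
  simp only [map_add, map_sub, smul_add, smul_sub]
  have h4 := congrArg₂ (· + ·) (congrArg₂ (· - ·) h1 h2) h3
  have h5 : (0 : Ser ι g) - lie (const (e i)) (expand e mcCoeff (e j)) -
      (0 - lie (const (e j)) (expand e mcCoeff (e i))) +
      (lie (const (e i)) (expand e mcCoeff (e j)) +
        -lie (const (e j)) (expand e mcCoeff (e i))) = 0 := by abel
  rw [h5] at h4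
  rw [← h4, one_add_one_eq_two]
  abel

/-- `exp (-ad v) x` is a flat section of the connection `d + ad θ`. The difference of the two sides
is annihilated by `E + 1 + ad v`. -/
theorem pd_expNeg (i : ι) (x : g) :
    pd i (expand e expNegCoeff x) = -lie (expand e mcCoeff (e i)) (expand e expNegCoeff x) := by
  rw [← sub_eq_zero, sub_neg_eq_add]
  have h1 := euler_add_pd e 0 i (expand e expNegCoeff x)
  have h3 := euler_add_lie e 1 0 (expand e mcCoeff (e i)) (expand e expNegCoeff x)
  rw [zero_smul, add_zero, euler_add_expNeg, map_zero, zero_sub] at h1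
  rw [euler_add_mc] at h3
  simp only [zero_smul, add_zero, euler_add_expNeg, map_zero] at h3
  refine eq_zero_of_euler_add e one_ne_zero ?_
  simp only [map_add, smul_add]
  have h4 := congrArg₂ (· + ·) h1 h3
  simp only [zero_add, neg_add_cancel] at h4
  rw [← h4]
  abel

/-- The Maurer-Cartan equation. -/
theorem act_mcForm (D D' : Der ι) :
    act D (mcForm e D') - act D' (mcForm e D) - mcForm e ⁅D, D'⁆ +
      lie (mcForm e D) (mcForm e D') = 0 := by
  have key : ∀ D D' : Der ι, act D (mcForm e D') =
      ∑ j, D (D' (MvPowerSeries.X j)) • expand e mcCoeff (e j) +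
        ∑ j, ∑ k, (D (MvPowerSeries.X j) * D' (MvPowerSeries.X k)) •
          pd j (expand e mcCoeff (e k)) := by
    intro D D'
    rw [mcForm_apply, map_sum, Finset.sum_congr rfl fun j _ => act_smul D _ _,
      Finset.sum_add_distrib, Finset.sum_comm (γ := ι)]
    congr 1
    refine Finset.sum_congr rfl fun j _ => ?_
    rw [act_apply, Finset.smul_sum]
    exact Finset.sum_congr rfl fun k _ => by rw [smul_smul, mul_comm]
  have hb : mcForm e ⁅D, D'⁆ = ∑ j, D (D' (MvPowerSeries.X j)) • expand e mcCoeff (e j) -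
      ∑ j, D' (D (MvPowerSeries.X j)) • expand e mcCoeff (e j) := by
    rw [mcForm_apply, ← Finset.sum_sub_distrib]
    exact Finset.sum_congr rfl fun j _ => by rw [Derivation.commutator_apply, sub_smul]
  have hl : lie (mcForm e D) (mcForm e D') =
      ∑ j, ∑ k, (D (MvPowerSeries.X j) * D' (MvPowerSeries.X k)) •
        lie (expand e mcCoeff (e j)) (expand e mcCoeff (e k)) := by
    rw [mcForm_apply, mcForm_apply, map_sum lie, LinearMap.sum_apply]
    refine Finset.sum_congr rfl fun j _ => ?_
    rw [map_sum]
    refine Finset.sum_congr rfl fun k _ => ?_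
    rw [map_smul, map_smul, LinearMap.smul_apply, smul_smul, mul_comm]
  have hc : ∑ j, ∑ k, (D' (MvPowerSeries.X j) * D (MvPowerSeries.X k)) •
          pd j (expand e mcCoeff (e k)) =
      ∑ j, ∑ k, (D (MvPowerSeries.X j) * D' (MvPowerSeries.X k)) •
          pd k (expand e mcCoeff (e j)) := by
    rw [Finset.sum_comm]
    exact Finset.sum_congr rfl fun j _ => Finset.sum_congr rfl fun k _ => by rw [mul_comm]
  -- The derivatives of the components of `D` and `D'` are absorbed by `θ [D, D']`; only double sums
  -- remain, and these vanish term by term by flatness on the basis.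
  have hz : ∑ j, ∑ k, (D (MvPowerSeries.X j) * D' (MvPowerSeries.X k)) •
          pd j (expand e mcCoeff (e k)) -
      ∑ j, ∑ k, (D (MvPowerSeries.X j) * D' (MvPowerSeries.X k)) •
          pd k (expand e mcCoeff (e j)) +
      ∑ j, ∑ k, (D (MvPowerSeries.X j) * D' (MvPowerSeries.X k)) •
        lie (expand e mcCoeff (e j)) (expand e mcCoeff (e k)) = 0 := by
    simp only [← Finset.sum_sub_distrib, ← Finset.sum_add_distrib, ← smul_sub, ← smul_add,
      mc_flat_basis, smul_zero, Finset.sum_const_zero]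
  rw [key, key, hb, hl, hc, ← hz]
  abel

theorem act_expNeg (D : Der ι) (x : g) :
    act D (expand e expNegCoeff x) = -lie (mcForm e D) (expand e expNegCoeff x) := by
  rw [act_apply, mcForm_apply, map_sum, LinearMap.sum_apply, ← Finset.sum_neg_distrib]
  refine Finset.sum_congr rfl fun j _ => ?_
  rw [pd_expNeg, map_smul, LinearMap.smul_apply, smul_neg]

/-- `∑ b_r t^r` is inverse to `(1 - exp (-t)) / t`, so it undoes `θ` and leaves the coordinate
vector of `D`. -/
theorem advSeries_bCoeff_mcForm (D : Der ι) :
    advSeries e bCoeff (mcForm e D) = ∑ j, D (MvPowerSeries.X j) • const (e j) := by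
  rw [mcForm_apply, map_sum]
  refine Finset.sum_congr rfl fun j _ => ?_
  rw [map_smul, advSeries_expand e _ _ _ _ sum_bCoeff_mul_mcCoeff,
    expand_eq_const e (by simp) (by simp)]

end Ser

namespace Ser

theorem coeff_zero_smul {ι M : Type*} [AddCommGroup M] [Module ℝ M] (f : FPS ι) (s : Ser ι M) :
    coeff 0 (f • s) = MvPowerSeries.constantCoeff f • coeff 0 s := by
  classical
  simp [coeff_smul]

end Ser

/-! ### The fields in the moving frame -/

section Frame

open Ser

variable {g : Type*} [LieRing g] [LieAlgebra ℝ g] {i₀ : LieSubalgebra ℝ g} {V : Submodule ℝ g}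
  (hV : IsCompl V i₀.toSubmodule)

@[simp] theorem proj_coe (w : V) : proj hV (w : g) = w := V.projectionOnto_apply_left hV w

theorem proj_eq_zero_iff {x : g} : proj hV x = 0 ↔ x ∈ i₀ :=
  Submodule.projectionOnto_apply_eq_zero_iff hV

theorem sub_proj_mem (x : g) : x - (proj hV x : g) ∈ i₀ := by
  rw [← proj_eq_zero_iff hV, map_sub, proj_coe, sub_self]

/-- The map induced on `V` by the isotropy action of `x ∈ i₀` on `g / i₀`. -/
def isoAct (x : g) : V →ₗ[ℝ] V := proj hV ∘ₗ adL x ∘ₗ V.subtype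

theorem isoAct_apply (x : g) (w : V) : isoAct hV x w = proj hV ⁅x, (w : g)⁆ := rfl

/-- Since `i₀` is a subalgebra, `ad x` descends to `g / i₀`, which `V` represents. -/
theorem isoAct_proj {x : g} (hx : x ∈ i₀) (y : g) : isoAct hV x (proj hV y) = proj hV ⁅x, y⁆ := by
  rw [isoAct_apply, ← sub_eq_zero, ← map_sub, ← lie_sub, proj_eq_zero_iff, ← neg_sub, lie_neg]
  exact i₀.neg_mem (i₀.lie_mem hx (sub_proj_mem hV y))

variable {ι : Type*} (e : Module.Basis ι ℝ V) (c : ℕ → ℝ)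

/-- The series `H` with values in `i₀`. -/
def isoSer (x : g) : Ser ι g := Ser.mk fun m => isoTerm hV e c m.degree x m

theorem coeff_isoSer_mem (x : g) (m : ι →₀ ℕ) : coeff m (isoSer hV e c x) ∈ i₀ := by
  rw [isoSer, coeff_mk, isoTerm]
  exact sub_proj_mem hV _

theorem map_proj_isoSer (x : g) : map (proj hV) (isoSer hV e c x) = 0 := by
  refine Ser.ext fun m => ?_
  rw [coeff_map, map_zero, proj_eq_zero_iff]
  exact coeff_isoSer_mem hV e c x m

/-- The coordinate series of the field, as a series with values in `V`. -/
def fieldSer (x : g) : Ser ι V := Ser.mk fun m => fieldTerm hV e c m.degree x m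

/-- The basis vectors as elements of the Lie algebra. -/
def frame : ι → g := fun j => (e j : g)

variable [Fintype ι]

theorem coeff_fieldSer_add_isoSer (x : g) (m : ι →₀ ℕ) :
    ((coeff m (fieldSer hV e c x) : V) : g) + coeff m (isoSer hV e c x) =
      c m.degree • coeff m ((adv (frame e) ^ m.degree) (const x)) -
        ∑ r ∈ Finset.range m.degree,
          bCoeff (r + 1) • coeff m ((adv (frame e) ^ (r + 1)) (isoSer hV e c x)) := by
  have h1 : ((coeff m (fieldSer hV e c x) : V) : g) + coeff m (isoSer hV e c x) =
      (c m.degree • (((adGen (frame e)) ^ m.degree) ∘ₗ constSeries ι) -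
        ∑ r : Fin m.degree, bCoeff (r + 1) •
          (((adGen (frame e)) ^ ((r : ℕ) + 1)) ∘ₗ isoTerm hV e c (m.degree - 1 - r))) x m := by
    rw [isoSer, coeff_mk, isoTerm, fieldSer, coeff_mk, fieldTerm]
    exact add_sub_cancel _ _
  rw [h1, LinearMap.sub_apply, Pi.sub_apply, LinearMap.sum_apply, Finset.sum_apply,
    ← Fin.sum_univ_eq_sum_range fun r =>
      bCoeff (r + 1) • coeff m ((adv (frame e) ^ (r + 1)) (isoSer hV e c x))]
  congr 1
  · rw [← mk_constSeries, ← mk_adGen_pow]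
    rfl
  · refine Finset.sum_congr rfl fun r _ => ?_
    -- Only the part of `H` of degree `|m| - 1 - r` reaches `m` under `(ad v)^(r+1)`, and that part
    -- is a single recursive term.
    have h2 : coeff m ((adv (frame e) ^ ((r : ℕ) + 1)) (isoSer hV e c x)) =
        coeff m ((adv (frame e) ^ ((r : ℕ) + 1))
          (Ser.mk (isoTerm hV e c (m.degree - 1 - r) x))) := by
      refine coeff_adv_pow_congr _ fun n hn => ?_
      rw [isoSer, coeff_mk, coeff_mk]
      have hr := r.isLt
      have hd : m.degree - 1 - r = n.degree := by omega
      rw [hd]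
    rw [h2, ← mk_adGen_pow]
    rfl

/-- The identity that determines the field and the series `H`. -/
theorem expand_eq_fieldSer_add (x : g) :
    expand (frame e) c x =
      map V.subtype (fieldSer hV e c x) + advSeries (frame e) bCoeff (isoSer hV e c x) := by
  ext m
  have h := coeff_fieldSer_add_isoSer hV e c x m
  rw [map_add, coeff_map, coeff_advSeries, Finset.sum_range_succ', coeff_expand, bCoeff_zero,
    one_smul, pow_zero, Module.End.one_apply]
  rw [eq_sub_iff_add_eq] at h
  rw [← h, Submodule.subtype_apply, add_assoc, add_comm (coeff m (isoSer hV e c x))]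

theorem field_X (x : g) (j : ι) : field hV e c x (MvPowerSeries.X j) = fieldCoord hV e c j x :=
  sum_smul_pderiv_X (fun j => fieldCoord hV e c j x) j

theorem coeff_field_X (x : g) (j : ι) (m : ι →₀ ℕ) :
    MvPowerSeries.coeff m (field hV e c x (MvPowerSeries.X j)) =
      e.coord j (coeff m (fieldSer hV e c x)) := by
  rw [field_X]; rfl

theorem sum_field_X_smul (x : g) :
    ∑ j, field hV e c x (MvPowerSeries.X j) • const (frame e j) =
      map V.subtype (fieldSer hV e c x) := by
  ext m
  rw [map_sum, coeff_map]
  conv_rhs => rw [← e.sum_repr (coeff m (fieldSer hV e c x)), map_sum]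
  refine Finset.sum_congr rfl fun j _ => ?_
  rw [coeff_smul_const, coeff_field_X]
  rfl

/-- The hypothesis says that `q` is the quotient of the series `c` by `b`: the claim is the defining
identity divided by the injective operator `∑ b_r (ad v)^r`. The quotient is `1` for `L_X^*` and
`exp (-t)` for `R_X^*`. -/
theorem mcForm_field {q : ℕ → ℝ}
    (h : ∀ n, ∑ r ∈ Finset.range (n + 1), bCoeff r * q (n - r) = c n) (x : g) :
    mcForm (frame e) (field hV e c x) = expand (frame e) q x - isoSer hV e c x := by
  apply advSeries_injective (frame e) bCoeff_zero
  rw [advSeries_bCoeff_mcForm, sum_field_X_smul, map_sub, advSeries_expand _ _ _ _ _ h,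
    expand_eq_fieldSer_add hV e]
  abel

theorem mcForm_fieldL (x : g) :
    mcForm (frame e) (fieldL hV e x) = const x - isoSer hV e bCoeff x := by
  rw [fieldL, mcForm_field hV e bCoeff (q := fun n => if n = 0 then 1 else 0),
    expand_eq_const _ (by simp) (by simp)]
  intro n
  rw [Finset.sum_range_succ, Finset.sum_eq_zero]
  · simp
  · intro r hr
    rw [Finset.mem_range] at hr
    rw [if_neg (by omega), mul_zero]

theorem mcForm_fieldR (x : g) :
    mcForm (frame e) (fieldR hV e x) =
      expand (frame e) expNegCoeff x - isoSer hV e (fun h => (-1) ^ h * bCoeff h) x :=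
  mcForm_field hV e _ sum_bCoeff_mul_expNegCoeff x

/-! ### Components in the frame of the fields `L_w^*` -/

/-- The components of a formal vector field in the frame of the fields `L_w^*`. -/
def comps : Der ι →ₗ[FPS ι] Ser ι V := map (proj hV) ∘ₗ mcForm (frame e)

theorem comps_apply (D : Der ι) : comps hV e D = map (proj hV) (mcForm (frame e) D) := rfl

theorem comps_fieldL (w : V) : comps hV e (fieldL hV e w) = const w := by
  rw [comps_apply, mcForm_fieldL, map_sub, map_proj_isoSer, sub_zero, Ser.map_const, proj_coe]

theorem coeff_zero_comps (D : Der ι) : coeff 0 (comps hV e D) = evalZero e D := by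
  rw [comps_apply, coeff_map, mcForm_apply, map_sum, map_sum]
  refine Finset.sum_congr rfl fun j _ => ?_
  rw [coeff_zero_smul, map_smul, coeff_expand]
  simp [mcCoeff, frame]

/-- If the components vanish, `θ(D)` is valued in `i₀`, whereas `∑ b_r (ad v)^r θ(D)` is the
coordinate vector of `D`, valued in `V`. Their lowest-degree coefficients agree, so they lie in `V ∩
i₀ = 0`. -/
theorem comps_injective : Function.Injective (comps hV e) := by
  rw [injective_iff_map_eq_zero]
  intro D hD
  have hH : ∀ m, coeff m (mcForm (frame e) D) ∈ i₀ := fun m => by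
    rw [← proj_eq_zero_iff hV, ← coeff_map, ← comps_apply, hD, map_zero]
  have hv : ∀ m, coeff m (advSeries (frame e) bCoeff (mcForm (frame e) D)) =
      ((∑ j, MvPowerSeries.coeff m (D (MvPowerSeries.X j)) • e j : V) : g) := fun m => by
    rw [advSeries_bCoeff_mcForm, map_sum, AddSubmonoidClass.coe_finsetSum]
    exact Finset.sum_congr rfl fun j _ => coeff_smul_const _ _ _
  have h0 : mcForm (frame e) D = 0 := by
    refine eq_zero_of_coeff fun m hm => ?_
    have h1 := coeff_advSeries_of_lower (frame e) bCoeff_zero hm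
    have h2 := hH m
    rw [← h1, hv] at h2
    rw [← h1, hv]
    exact Submodule.disjoint_def.1 hV.disjoint _ (Subtype.coe_prop _) h2
  refine derivation_eq_zero fun j => ?_
  ext m
  have h1 := hv m
  rw [h0, map_zero, map_zero, eq_comm, ZeroMemClass.coe_eq_zero] at h1
  exact Fintype.linearIndependent_iff.1 e.linearIndependent _ h1 j

/-- The Lie derivative by `R_x^*` in the frame of the fields `L_w^*`. -/
theorem comps_fieldR_lie (x : g) (D : Der ι) :
    comps hV e ⁅fieldR hV e x, D⁆ = act (fieldR hV e x) (comps hV e D) -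
      map (proj hV) (lie (isoSer hV e (fun h => (-1) ^ h * bCoeff h) x) (mcForm (frame e) D)) := by
  set H := isoSer hV e (fun h => (-1) ^ h * bCoeff h) x with hH
  have h := act_mcForm (frame e) (fieldR hV e x) D
  -- By flatness the two contributions of `exp (-ad v) x` cancel. What is left besides the claim is
  -- the derivative of `H'` along `D`, which is valued in `i₀` and so projects to zero.
  rw [mcForm_fieldR, map_sub, act_expNeg, map_sub, LinearMap.sub_apply,
    lie_skew (mcForm (frame e) D), ← hH] at h
  have h2 : mcForm (frame e) ⁅fieldR hV e x, D⁆ = act (fieldR hV e x) (mcForm (frame e) D) +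
      act D H - lie H (mcForm (frame e) D) := by
    rw [← sub_eq_zero, ← neg_eq_zero, ← h]
    abel
  rw [comps_apply, h2, map_sub, map_add, ← act_map, ← act_map, hH, map_proj_isoSer, map_zero,
    add_zero, comps_apply]

/-- The coefficient of a formal vector field in the frame of the fields `L_w^*`. -/
def comp (m : ι →₀ ℕ) : Der ι →ₗ[ℝ] V := coeff m ∘ₗ (comps hV e).restrictScalars ℝ

theorem comp_apply (m : ι →₀ ℕ) (D : Der ι) : comp hV e m D = coeff m (comps hV e D) := rfl

open Classical in
theorem comp_fieldR_lie (x : g) (m : ι →₀ ℕ) (D : Der ι) :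
    comp hV e m ⁅fieldR hV e x, D⁆ =
      ∑ j, ∑ p ∈ antidiagonal m,
          (MvPowerSeries.coeff p.1 (fieldR hV e x (MvPowerSeries.X j)) * ((p.2 j + 1 : ℕ) : ℝ)) •
            comp hV e (p.2 + Finsupp.single j 1) D -
        ∑ p ∈ antidiagonal m,
          isoAct hV (coeff p.1 (isoSer hV e (fun h => (-1) ^ h * bCoeff h) x))
            (comp hV e p.2 D) := by
  rw [comp_apply, comps_fieldR_lie, map_sub, act_apply, map_sum, coeff_map, coeff_lie, map_sum]
  congr 1
  · refine Finset.sum_congr rfl fun j _ => ?_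
    rw [coeff_smul]
    refine Finset.sum_congr rfl fun p _ => ?_
    rw [coeff_pd, ← Nat.cast_smul_eq_nsmul ℝ, smul_smul, comp_apply]
  · refine Finset.sum_congr rfl fun p _ => ?_
    rw [comp_apply, comps_apply, coeff_map, isoAct_proj hV (coeff_isoSer_mem hV e _ x _)]

theorem coeff_zero_fieldSer_add_isoSer (h0 : c 0 = 1) (x : g) :
    ((coeff 0 (fieldSer hV e c x) : V) : g) + coeff 0 (isoSer hV e c x) = x := by
  rw [coeff_fieldSer_add_isoSer]
  simp [h0]

theorem coeff_zero_fieldSer (h0 : c 0 = 1) (x : g) :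
    coeff 0 (fieldSer hV e c x) = proj hV x := by
  conv_rhs => rw [← coeff_zero_fieldSer_add_isoSer hV e c h0 x, map_add, proj_coe]
  rw [(proj_eq_zero_iff hV).2 (coeff_isoSer_mem hV e c x 0), add_zero]

theorem coeff_zero_fieldR_X (x : g) (j : ι) :
    MvPowerSeries.coeff 0 (fieldR hV e x (MvPowerSeries.X j)) = e.coord j (proj hV x) := by
  rw [fieldR, coeff_field_X, coeff_zero_fieldSer]
  simp [bCoeff_zero]

theorem coeff_zero_isoSer (h0 : c 0 = 1) {x : g} (hx : x ∈ i₀) :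
    coeff 0 (isoSer hV e c x) = x := by
  have h := coeff_zero_fieldSer_add_isoSer hV e c h0 x
  rwa [coeff_zero_fieldSer hV e c h0, (proj_eq_zero_iff hV).2 hx, ZeroMemClass.coe_zero,
    zero_add] at h

end Frame

/-! ### Complexification -/

section Complexification

theorem exists_eq_one_tmul_add_I_tmul {E : Type*} [AddCommGroup E] [Module ℝ E] (z : ℂ ⊗[ℝ] E) :
    ∃ a b : E, z = (1 : ℂ) ⊗ₜ[ℝ] a + Complex.I ⊗ₜ[ℝ] b := by
  induction z using TensorProduct.induction_on with
  | zero => exact ⟨0, 0, by simp⟩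
  | tmul c x =>
    refine ⟨c.re • x, c.im • x, ?_⟩
    rw [← TensorProduct.smul_tmul, ← TensorProduct.smul_tmul, ← TensorProduct.add_tmul]
    congr 1
    apply Complex.ext <;> simp
  | add z z' h h' =>
    obtain ⟨a, b, rfl⟩ := h
    obtain ⟨a', b', rfl⟩ := h'
    exact ⟨a + a', b + b', by rw [TensorProduct.tmul_add, TensorProduct.tmul_add]; abel⟩

theorem one_tmul_add_I_tmul_eq_zero {E : Type*} [AddCommGroup E] [Module ℝ E] {a b : E}
    (h : (1 : ℂ) ⊗ₜ[ℝ] a + Complex.I ⊗ₜ[ℝ] b = 0) : a = 0 ∧ b = 0 := by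
  have h1 := congrArg (TensorProduct.lid ℝ E ∘ LinearMap.rTensor E Complex.reLm) h
  have h2 := congrArg (TensorProduct.lid ℝ E ∘ LinearMap.rTensor E Complex.imLm) h
  simp at h1 h2
  exact ⟨h1, h2⟩

theorem one_tmul_lie_add {L : Type*} [LieRing L] [LieAlgebra ℝ L] (x : L) (y z : ℂ ⊗[ℝ] L) :
    ⁅((1 : ℂ) ⊗ₜ[ℝ] x : ℂ ⊗[ℝ] L), y + z⁆ =
      ⁅((1 : ℂ) ⊗ₜ[ℝ] x : ℂ ⊗[ℝ] L), y⁆ + ⁅((1 : ℂ) ⊗ₜ[ℝ] x : ℂ ⊗[ℝ] L), z⁆ :=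
  lie_add (L := ℂ ⊗[ℝ] L) (M := ℂ ⊗[ℝ] L) _ y z

theorem one_tmul_lie_zero {L : Type*} [LieRing L] [LieAlgebra ℝ L] (x : L) :
    ⁅((1 : ℂ) ⊗ₜ[ℝ] x : ℂ ⊗[ℝ] L), (0 : ℂ ⊗[ℝ] L)⁆ = 0 :=
  lie_zero (L := ℂ ⊗[ℝ] L) (M := ℂ ⊗[ℝ] L) _

/-! ### The local ring `ℂ ⊗ 𝓕` -/

section Coefficients

variable {ι : Type*}

/-- The coefficients of elements of `ℂ ⊗ 𝓕`. -/
def coeffC (m : ι →₀ ℕ) : ℂ ⊗[ℝ] FPS ι →ₗ[ℂ] ℂ :=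
  (TensorProduct.AlgebraTensorModule.rid ℝ ℂ ℂ).toLinearMap ∘ₗ
    (MvPowerSeries.coeff m : FPS ι →ₗ[ℝ] ℝ).baseChange ℂ

theorem coeffC_tmul (m : ι →₀ ℕ) (c : ℂ) (f : FPS ι) :
    coeffC m (c ⊗ₜ[ℝ] f) = MvPowerSeries.coeff m f • c := rfl

/-- The constant coefficient on `ℂ ⊗ 𝓕`. -/
def constCoeffC : ℂ ⊗[ℝ] FPS ι →ₐ[ℂ] ℂ :=
  Algebra.TensorProduct.lift (AlgHom.id ℂ ℂ)
    ((Algebra.ofId ℝ ℂ).comp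
      { (MvPowerSeries.constantCoeff : FPS ι →+* ℝ) with commutes' := fun _ => rfl })
    (fun _ _ => Commute.all _ _)

theorem constCoeffC_apply (x : ℂ ⊗[ℝ] FPS ι) : constCoeffC x = coeffC 0 x := by
  induction x using TensorProduct.induction_on with
  | zero => simp
  | tmul c f =>
    rw [constCoeffC, Algebra.TensorProduct.lift_tmul, coeffC_tmul, Complex.real_smul, mul_comm]
    rfl
  | add x y hx hy => rw [map_add, map_add, hx, hy]

/-- Multiplying `a + i b` by its conjugate gives the real series `a² + b²`, whose constant term is
zero only if those of `a` and `b` both are. -/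
theorem isUnit_of_constCoeffC_ne_zero {x : ℂ ⊗[ℝ] FPS ι} (hx : constCoeffC x ≠ 0) : IsUnit x := by
  obtain ⟨a, b, rfl⟩ := exists_eq_one_tmul_add_I_tmul x
  have h1 : ((1 : ℂ) ⊗ₜ[ℝ] a + Complex.I ⊗ₜ[ℝ] b : ℂ ⊗[ℝ] FPS ι) *
      ((1 : ℂ) ⊗ₜ[ℝ] a - Complex.I ⊗ₜ[ℝ] b) = (1 : ℂ) ⊗ₜ[ℝ] (a * a + b * b) := by
    simp only [add_mul, mul_sub, Algebra.TensorProduct.tmul_mul_tmul, Complex.I_mul_I, one_mul,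
      mul_one, TensorProduct.neg_tmul, TensorProduct.tmul_add, mul_comm b a]
    abel
  have h2 : IsUnit (a * a + b * b) := by
    rw [MvPowerSeries.isUnit_iff_constantCoeff, isUnit_iff_ne_zero]
    intro h0
    rw [map_add, map_mul, map_mul] at h0
    obtain ⟨ha, hb⟩ := mul_self_add_mul_self_eq_zero.1 h0
    apply hx
    rw [constCoeffC_apply, map_add, coeffC_tmul, coeffC_tmul,
      MvPowerSeries.coeff_zero_eq_constantCoeff_apply,
      MvPowerSeries.coeff_zero_eq_constantCoeff_apply, ha, hb]
    simp
  refine isUnit_of_mul_isUnit_left (y := (1 : ℂ) ⊗ₜ[ℝ] a - Complex.I ⊗ₜ[ℝ] b) ?_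
  rw [h1]
  exact h2.map (Algebra.TensorProduct.includeRight : FPS ι →ₐ[ℝ] ℂ ⊗[ℝ] FPS ι)

theorem ker_constCoeffC_le_jacobson :
    RingHom.ker (constCoeffC : ℂ ⊗[ℝ] FPS ι →ₐ[ℂ] ℂ) ≤ Ideal.jacobson ⊥ := by
  intro x hx
  rw [Ideal.mem_jacobson_bot]
  intro y
  refine isUnit_of_constCoeffC_ne_zero ?_
  rw [map_add, map_mul, RingHom.mem_ker.1 hx, map_one]
  simp

end Coefficients

/-! ### Complexified projection and isotropy action -/

variable {g : Type*} [LieRing g] [LieAlgebra ℝ g] {i₀ : LieSubalgebra ℝ g} {V : Submodule ℝ g}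
  (hV : IsCompl V i₀.toSubmodule)

/-- The inclusion of the complexification of `V`. -/
def inclC (V : Submodule ℝ g) : ℂ ⊗[ℝ] V →ₗ[ℂ] ℂ ⊗[ℝ] g := V.subtype.baseChange ℂ

/-- The projection to the complexification of `V`. -/
def projC : ℂ ⊗[ℝ] g →ₗ[ℂ] ℂ ⊗[ℝ] V := (proj hV).baseChange ℂ

/-- The complexified isotropy action. -/
def isoActC (x : g) : ℂ ⊗[ℝ] V →ₗ[ℂ] ℂ ⊗[ℝ] V := (isoAct hV x).baseChange ℂ

theorem projC_inclC (w : ℂ ⊗[ℝ] V) : projC hV (inclC V w) = w := by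
  induction w using TensorProduct.induction_on with
  | zero => simp
  | tmul c w => rw [inclC, projC, LinearMap.baseChange_tmul, LinearMap.baseChange_tmul,
      Submodule.subtype_apply, proj_coe]
  | add w w' h h' => rw [map_add, map_add, h, h']

theorem sub_inclC_projC_mem (y : ℂ ⊗[ℝ] g) :
    y - inclC V (projC hV y) ∈ i₀.toSubmodule.baseChange ℂ := by
  induction y using TensorProduct.induction_on with
  | zero => simp
  | tmul c y =>
    rw [inclC, projC, LinearMap.baseChange_tmul, LinearMap.baseChange_tmul, ← TensorProduct.tmul_sub]
    exact Submodule.tmul_mem_baseChange_of_mem _ (sub_proj_mem hV y)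
  | add y y' h h' =>
    rw [map_add, map_add, add_sub_add_comm]
    exact Submodule.add_mem _ h h'

theorem projC_eq_zero {y : ℂ ⊗[ℝ] g} (hy : y ∈ i₀.toSubmodule.baseChange ℂ) : projC hV y = 0 := by
  obtain ⟨z, rfl⟩ := hy
  induction z using TensorProduct.induction_on with
  | zero => simp
  | tmul c z =>
    rw [projC, LinearMap.baseChange_tmul, LinearMap.baseChange_tmul, Submodule.subtype_apply,
      (proj_eq_zero_iff hV).2 z.2, TensorProduct.tmul_zero]
  | add z z' h h' => rw [map_add, map_add, h, h', add_zero]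

theorem isoActC_projC {x : g} (hx : x ∈ i₀) (y : ℂ ⊗[ℝ] g) :
    isoActC hV x (projC hV y) = projC hV ⁅(1 : ℂ) ⊗ₜ[ℝ] x, y⁆ := by
  induction y using TensorProduct.induction_on with
  | zero => rw [one_tmul_lie_zero, map_zero, map_zero]
  | tmul c y =>
    rw [LieAlgebra.ExtendScalars.bracket_tmul, projC, isoActC, LinearMap.baseChange_tmul,
      LinearMap.baseChange_tmul, LinearMap.baseChange_tmul, isoAct_proj hV hx, one_mul]
  | add y y' h h' => rw [one_tmul_lie_add, map_add, map_add, map_add, h, h']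

/-- An element and its `V`-part differ by an element of `i ⊆ l`. Hence `l` is determined by its
intersection with `V^ℂ`. -/
theorem inclC_projC_mem {l : Submodule ℂ (ℂ ⊗[ℝ] g)} (hl : i₀.toSubmodule.baseChange ℂ ≤ l)
    {y : ℂ ⊗[ℝ] g} : inclC V (projC hV y) ∈ l ↔ y ∈ l := by
  have h := l.add_mem_iff_right (y := inclC V (projC hV y)) (hl (sub_inclC_projC_mem hV y))
  rw [sub_add_cancel] at h
  exact h.symm

theorem isoActC_mem {l : Submodule ℂ (ℂ ⊗[ℝ] g)} (hl : l ∈ isotropySubmodules i₀) {x : g}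
    (hx : x ∈ i₀) {w : ℂ ⊗[ℝ] V} (hw : w ∈ l.comap (inclC V)) :
    isoActC hV x w ∈ l.comap (inclC V) := by
  rw [← projC_inclC hV w, isoActC_projC hV hx, Submodule.mem_comap, inclC_projC_mem hV hl.1]
  exact hl.2 _ (Submodule.tmul_mem_baseChange_of_mem _ hx) _ hw

/-! ### Complex formal vector fields in the frame -/

variable {ι : Type*} [Fintype ι] (e : Module.Basis ι ℝ V)

/-- The coefficients of complex formal vector fields in the frame of the fields `L_w^*`. -/
def compC (m : ι →₀ ℕ) : ℂ ⊗[ℝ] Der ι →ₗ[ℂ] ℂ ⊗[ℝ] V := (comp hV e m).baseChange ℂ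

theorem compC_tmul (m : ι →₀ ℕ) (c : ℂ) (D : Der ι) :
    compC hV e m (c ⊗ₜ[ℝ] D) = c ⊗ₜ[ℝ] comp hV e m D := rfl

theorem compC_zero : compC hV e 0 = (evalZero e).baseChange ℂ := by
  have h : comp hV e 0 = evalZero e := LinearMap.ext fun D => coeff_zero_comps hV e D
  rw [compC, h]

theorem compC_ext {T T' : ℂ ⊗[ℝ] Der ι} (h : ∀ m, compC hV e m T = compC hV e m T') : T = T' := by
  rw [← sub_eq_zero]
  replace h : ∀ m, compC hV e m (T - T') = 0 := fun m => by rw [map_sub, h, sub_self]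
  obtain ⟨a, b, hab⟩ := exists_eq_one_tmul_add_I_tmul (T - T')
  rw [hab] at h ⊢
  simp only [map_add, compC_tmul] at h
  have ha : a = 0 := comps_injective hV e <| by
    rw [map_zero]
    exact Ser.ext fun m => (one_tmul_add_I_tmul_eq_zero (h m)).1
  have hb : b = 0 := comps_injective hV e <| by
    rw [map_zero]
    exact Ser.ext fun m => (one_tmul_add_I_tmul_eq_zero (h m)).2
  rw [ha, hb]
  simp

open Classical in
theorem compC_smul (m : ι →₀ ℕ) (x : ℂ ⊗[ℝ] FPS ι) (T : ℂ ⊗[ℝ] Der ι) :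
    compC hV e m (x • T) = ∑ p ∈ antidiagonal m, coeffC p.1 x • compC hV e p.2 T := by
  induction x using TensorProduct.induction_on with
  | zero =>
    exact (congrArg (compC hV e m) (zero_smul (ℂ ⊗[ℝ] FPS ι) T)).trans (by simp)
  | add x y hx hy =>
    simp only [add_smul, map_add, hx, hy, Finset.sum_add_distrib]
  | tmul c f =>
    induction T using TensorProduct.induction_on with
    | zero => simp
    | add T T' h h' => simp only [smul_add, map_add, h, h', Finset.sum_add_distrib]
    | tmul d D =>
      rw [tmul_smul_tmul, compC_tmul, comp_apply, map_smul, Ser.coeff_smul,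
        TensorProduct.tmul_sum]
      refine Finset.sum_congr rfl fun p _ => ?_
      rw [compC_tmul, coeffC_tmul, comp_apply, TensorProduct.tmul_smul, smul_assoc,
        TensorProduct.smul_tmul' c, smul_eq_mul]

open Classical in
theorem compC_fieldR_lie (x : g) (m : ι →₀ ℕ) (T : ℂ ⊗[ℝ] Der ι) :
    compC hV e m ⁅((1 : ℂ) ⊗ₜ[ℝ] fieldR hV e x : ℂ ⊗[ℝ] Der ι), T⁆ =
      ∑ j, ∑ p ∈ antidiagonal m,
          (MvPowerSeries.coeff p.1 (fieldR hV e x (MvPowerSeries.X j)) * ((p.2 j + 1 : ℕ) : ℝ)) •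
            compC hV e (p.2 + Finsupp.single j 1) T -
        ∑ p ∈ antidiagonal m,
          isoActC hV (Ser.coeff p.1 (isoSer hV e (fun h => (-1) ^ h * bCoeff h) x))
            (compC hV e p.2 T) := by
  induction T using TensorProduct.induction_on with
  | zero => rw [one_tmul_lie_zero]; simp
  | add T T' h h' =>
    rw [one_tmul_lie_add]
    simp only [map_add, smul_add, Finset.sum_add_distrib, h, h']
    abel
  | tmul c D =>
    rw [LieAlgebra.ExtendScalars.bracket_tmul, one_mul, compC_tmul, comp_fieldR_lie,
      TensorProduct.tmul_sub, TensorProduct.tmul_sum, TensorProduct.tmul_sum]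
    congr 1
    refine Finset.sum_congr rfl fun j _ => ?_
    rw [TensorProduct.tmul_sum]
    exact Finset.sum_congr rfl fun p _ => by rw [compC_tmul, TensorProduct.tmul_smul]

/-- The map `w ↦ L_w^*` on the complexification of `V`. -/
def fieldC : ℂ ⊗[ℝ] V →ₗ[ℂ] ℂ ⊗[ℝ] Der ι := (fieldL hV e).baseChange ℂ ∘ₗ inclC V

open Classical in
theorem compC_fieldC (w : ℂ ⊗[ℝ] V) (m : ι →₀ ℕ) :
    compC hV e m (fieldC hV e w) = if m = 0 then w else 0 := by
  induction w using TensorProduct.induction_on with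
  | zero => simp
  | add w w' h h' =>
    rw [map_add, map_add, h, h']
    split_ifs <;> simp
  | tmul c w =>
    rw [fieldC, LinearMap.comp_apply, inclC, LinearMap.baseChange_tmul, LinearMap.baseChange_tmul,
      compC_tmul, comp_apply, Submodule.subtype_apply, comps_fieldL, Ser.coeff_const]
    split_ifs <;> simp

theorem compC_smul_fieldC (m : ι →₀ ℕ) (x : ℂ ⊗[ℝ] FPS ι) (w : ℂ ⊗[ℝ] V) :
    compC hV e m (x • fieldC hV e w) = coeffC m x • w := by
  classical
  rw [compC_smul, Finset.sum_eq_single (m, 0)]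
  · rw [compC_fieldC, if_pos rfl]
  · rintro ⟨a, b⟩ h hne
    rw [compC_fieldC, if_neg, smul_zero]
    rintro rfl
    rw [mem_antidiagonal] at h
    exact hne (by simpa using h)
  · simp

/-- The coordinates on the complexification of `V`. -/
def coordC (j : ι) : ℂ ⊗[ℝ] V →ₗ[ℂ] ℂ :=
  (TensorProduct.AlgebraTensorModule.rid ℝ ℂ ℂ).toLinearMap ∘ₗ (e.coord j).baseChange ℂ

theorem sum_coordC_smul (w : ℂ ⊗[ℝ] V) : ∑ j, coordC e j w • ((1 : ℂ) ⊗ₜ[ℝ] e j) = w := by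
  induction w using TensorProduct.induction_on with
  | zero => simp
  | add w w' h h' => simp only [map_add, add_smul, Finset.sum_add_distrib, h, h']
  | tmul c w =>
    conv_rhs => rw [← e.sum_repr w, TensorProduct.tmul_sum]
    refine Finset.sum_congr rfl fun j _ => ?_
    rw [TensorProduct.tmul_smul, TensorProduct.smul_tmul', TensorProduct.smul_tmul']
    congr 1
    change (e.repr w j • c) • (1 : ℂ) = _
    simp

/-- The coordinate series of a formal vector field in the frame of the fields `L_{e j}^*`. -/
def coordSer (j : ι) : Der ι →ₗ[ℝ] FPS ι where
  toFun D := fun m => e.coord j (comp hV e m D)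
  map_add' D D' := by
    funext m
    change e.coord j (comp hV e m (D + D')) = e.coord j (comp hV e m D) + e.coord j (comp hV e m D')
    rw [map_add, map_add]
  map_smul' c D := by
    funext m
    change e.coord j (comp hV e m (c • D)) = c • e.coord j (comp hV e m D)
    rw [map_smul, map_smul]

/-- The coordinate series of a complex formal vector field in the frame of the `L_{e j}^*`. -/
def coordSerC (j : ι) : ℂ ⊗[ℝ] Der ι →ₗ[ℂ] ℂ ⊗[ℝ] FPS ι := (coordSer hV e j).baseChange ℂ

theorem coeffC_coordSerC (m : ι →₀ ℕ) (j : ι) (T : ℂ ⊗[ℝ] Der ι) :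
    coeffC m (coordSerC hV e j T) = coordC e j (compC hV e m T) := by
  induction T using TensorProduct.induction_on with
  | zero => simp
  | add T T' h h' => simp only [map_add, h, h']
  | tmul c D => rfl

/-- If all coefficients of `T` are fixed by `q`, then `T` is a combination of the
fields `L_{q (e j)}^*`. -/
theorem eq_sum_coordSerC_smul (q : ℂ ⊗[ℝ] V →ₗ[ℂ] ℂ ⊗[ℝ] V) {T : ℂ ⊗[ℝ] Der ι}
    (hT : ∀ m, q (compC hV e m T) = compC hV e m T) :
    T = ∑ j, coordSerC hV e j T • fieldC hV e (q ((1 : ℂ) ⊗ₜ[ℝ] e j)) := by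
  refine compC_ext hV e fun m => ?_
  rw [map_sum, ← hT]
  conv_lhs => rw [← sum_coordC_smul e (compC hV e m T), map_sum]
  refine Finset.sum_congr rfl fun j _ => ?_
  rw [compC_smul_fieldC, coeffC_coordSerC, map_smul]

/-! ### Modules of fields with coefficients in a subspace of `V^ℂ` -/

/-- The complex formal vector fields with all coefficients in `W`. -/
def coeffModule (W : Submodule ℂ (ℂ ⊗[ℝ] V)) : Submodule (ℂ ⊗[ℝ] FPS ι) (ℂ ⊗[ℝ] Der ι) where
  carrier := {T | ∀ m, compC hV e m T ∈ W}
  zero_mem' m := by rw [map_zero]; exact W.zero_mem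
  add_mem' h h' m := by rw [map_add]; exact W.add_mem (h m) (h' m)
  smul_mem' x T h m := by
    classical
    rw [compC_smul]
    exact W.sum_mem fun p _ => W.smul_mem _ (h _)

theorem fieldC_mem_coeffModule {W : Submodule ℂ (ℂ ⊗[ℝ] V)} {w : ℂ ⊗[ℝ] V} (hw : w ∈ W) :
    fieldC hV e w ∈ coeffModule hV e W := by
  classical
  intro m
  rw [compC_fieldC]
  split_ifs
  exacts [hw, W.zero_mem]

theorem exists_projection (W : Submodule ℂ (ℂ ⊗[ℝ] V)) :
    ∃ q : ℂ ⊗[ℝ] V →ₗ[ℂ] ℂ ⊗[ℝ] V, (∀ w, q w ∈ W) ∧ ∀ w ∈ W, q w = w := by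
  obtain ⟨q, hq⟩ := W.subtype.exists_leftInverse_of_injective W.ker_subtype
  exact ⟨W.subtype ∘ₗ q, fun w => (q w).2,
    fun w hw => congrArg Subtype.val (LinearMap.congr_fun hq ⟨w, hw⟩)⟩

/-- A linear projection `q` onto `W` fixes all coefficients, so the finitely many `L_{q (e j)}^*`
generate. This finiteness is what Nakayama's lemma needs. -/
theorem coeffModule_eq_span (W : Submodule ℂ (ℂ ⊗[ℝ] V)) :
    ∃ u : ι → ℂ ⊗[ℝ] V, (∀ j, u j ∈ W) ∧
      coeffModule hV e W = Submodule.span _ (Set.range fun j => fieldC hV e (u j)) := by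
  obtain ⟨q, hq, hq'⟩ := exists_projection W
  refine ⟨fun j => q ((1 : ℂ) ⊗ₜ[ℝ] e j), fun j => hq _, le_antisymm ?_ ?_⟩
  · intro T hT
    rw [eq_sum_coordSerC_smul hV e q fun m => hq' _ (hT m)]
    exact Submodule.sum_mem _ fun j _ =>
      Submodule.smul_mem _ _ (Submodule.subset_span (Set.mem_range_self j))
  · rw [Submodule.span_le]
    rintro _ ⟨j, rfl⟩
    exact fieldC_mem_coeffModule hV e (hq _)

theorem starModule_eq_coeffModule (l : Submodule ℂ (ℂ ⊗[ℝ] g)) :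
    starModule hV e l = coeffModule hV e (l.comap (inclC V)) := by
  apply le_antisymm
  · rw [starModule, Submodule.span_le]
    rintro _ ⟨_, ⟨⟨w, rfl⟩, hl⟩, rfl⟩
    exact fieldC_mem_coeffModule hV e (w := w) hl
  · obtain ⟨u, hu, h⟩ := coeffModule_eq_span hV e (l.comap (inclC V))
    rw [h, Submodule.span_le]
    rintro _ ⟨j, rfl⟩
    exact Submodule.subset_span ⟨inclC V (u j), ⟨⟨u j, rfl⟩, hu j⟩, rfl⟩

/-- Differentiating along `R_x^*` only forms scalar combinations of coefficients; the remaining term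
acts by isotropy of elements of `i₀`, under which `l ∩ V^ℂ` is stable. -/
theorem starModule_mem_invariantModules {l : Submodule ℂ (ℂ ⊗[ℝ] g)}
    (hl : l ∈ isotropySubmodules i₀) : starModule hV e l ∈ invariantModules hV e := by
  classical
  rw [starModule_eq_coeffModule]
  intro x T hT m
  rw [compC_fieldR_lie]
  refine Submodule.sub_mem _ (Submodule.sum_mem _ fun j _ => Submodule.sum_mem _ fun p _ => ?_)
    (Submodule.sum_mem _ fun p _ => ?_)
  · exact Submodule.smul_of_tower_mem _ _ (hT _)
  · exact isoActC_mem hV hl (coeff_isoSer_mem hV e _ x _) (hT _)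

theorem mem_valueSubmodule {M : Submodule (ℂ ⊗[ℝ] FPS ι) (ℂ ⊗[ℝ] Der ι)} {y : ℂ ⊗[ℝ] g} :
    y ∈ valueSubmodule hV e M ↔ ∃ T ∈ M, projC hV y = compC hV e 0 T := by
  rw [compC_zero]
  rfl

theorem valueSubmodule_starModule {l : Submodule ℂ (ℂ ⊗[ℝ] g)}
    (hl : l ∈ isotropySubmodules i₀) : valueSubmodule hV e (starModule hV e l) = l := by
  classical
  rw [starModule_eq_coeffModule]
  ext y
  rw [mem_valueSubmodule, ← inclC_projC_mem hV hl.1]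
  constructor
  · rintro ⟨T, hT, h⟩
    rw [h]
    exact hT 0
  · intro h
    exact ⟨fieldC hV e (projC hV y), fieldC_mem_coeffModule hV e h, by simp [compC_fieldC]⟩

/-- For `x` in `i₀` the field `R_x^*` vanishes at `0`, so no derivative survives there, and `H'(0) =
x`. -/
theorem compC_zero_fieldR_lie {x : g} (hx : x ∈ i₀) (T : ℂ ⊗[ℝ] Der ι) :
    compC hV e 0 ⁅((1 : ℂ) ⊗ₜ[ℝ] fieldR hV e x : ℂ ⊗[ℝ] Der ι), T⁆ =
      -isoActC hV x (compC hV e 0 T) := by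
  classical
  rw [compC_fieldR_lie]
  simp [coeff_zero_fieldR_X, (proj_eq_zero_iff hV).2 hx, coeff_zero_isoSer hV e _ _ hx,
    bCoeff_zero]

theorem valueSubmodule_mem_isotropySubmodules
    {M : Submodule (ℂ ⊗[ℝ] FPS ι) (ℂ ⊗[ℝ] Der ι)} (hM : M ∈ invariantModules hV e) :
    valueSubmodule hV e M ∈ isotropySubmodules i₀ := by
  refine ⟨fun y hy => (mem_valueSubmodule hV e).2 ⟨0, M.zero_mem, ?_⟩, fun X hX Y hY => ?_⟩
  · rw [projC_eq_zero hV hy, map_zero]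
  · rw [Submodule.baseChange_eq_span] at hX
    induction hX using Submodule.span_induction with
    | mem X hX =>
      obtain ⟨x, hx, rfl⟩ := hX
      obtain ⟨T, hT, h⟩ := (mem_valueSubmodule hV e).1 hY
      refine (mem_valueSubmodule hV e).2 ⟨-_, M.neg_mem (hM x T hT), ?_⟩
      rw [map_neg, compC_zero_fieldR_lie hV e hx, neg_neg, ← h, isoActC_projC hV hx]
      rfl
    | zero => rw [zero_lie]; exact Submodule.zero_mem _
    | add X X' _ _ h h' => rw [add_lie]; exact Submodule.add_mem _ h h'
    | smul c X _ h => rw [smul_lie]; exact Submodule.smul_mem _ _ h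

/-! ### Invariant modules are recovered from their values at `0` -/

/-- The coefficients of the elements of an invariant module lie in its space of values. -/
theorem le_coeffModule_of_invariant
    {M : Submodule (ℂ ⊗[ℝ] FPS ι) (ℂ ⊗[ℝ] Der ι)} (hM : M ∈ invariantModules hV e) :
    M ≤ coeffModule hV e ((valueSubmodule hV e M).comap (inclC V)) := by
  classical
  have hl := valueSubmodule_mem_isotropySubmodules hV e hM
  set W := (valueSubmodule hV e M).comap (inclC V) with hW
  have key : ∀ d : ℕ, ∀ m : ι →₀ ℕ, m.degree = d → ∀ T ∈ M, compC hV e m T ∈ W := by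
    intro d
    induction d using Nat.strong_induction_on with
    | _ d ih =>
      intro m hm T hT
      by_cases hm0 : m = 0
      · subst hm0
        exact (mem_valueSubmodule hV e).2 ⟨T, hT, projC_inclC hV _⟩
      obtain ⟨j, hj⟩ := Finsupp.ne_iff.1 hm0
      obtain ⟨n, rfl⟩ : ∃ n, m = n + Finsupp.single j 1 :=
        ⟨m - Finsupp.single j 1, (tsub_add_cancel_of_le
          (by rw [Finsupp.single_le_iff]; exact Nat.one_le_iff_ne_zero.2 hj)).symm⟩
      rw [map_add, Finsupp.degree_single] at hm
      -- The induction hypothesis is applied to the bracket with `R_{e_j}^*`, again an element of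
      -- `M`, at the lower monomial `n`.
      have h1 := ih n.degree (by omega) n rfl _ (hM (e j) T hT)
      rw [compC_fieldR_lie, W.sub_mem_iff_left] at h1
      -- At the origin `R_{e_j}^*` is `∂_j`, so the constant coefficients of the field contribute
      -- only `n j + 1` times the wanted coefficient; every other term involves coefficients of `T`
      -- of degree at most `|n|`.
      · have h2 : ∀ k, ∑ p ∈ antidiagonal n,
            (MvPowerSeries.coeff p.1 (fieldR hV e (e j : g) (MvPowerSeries.X k)) *
              ((p.2 k + 1 : ℕ) : ℝ)) • compC hV e (p.2 + Finsupp.single k 1) T -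
              (if k = j then ((n j + 1 : ℕ) : ℝ) • compC hV e (n + Finsupp.single j 1) T
                else 0) ∈ W := by
          intro k
          have h0 : (0, n) ∈ antidiagonal n := by rw [mem_antidiagonal, zero_add]
          have h3 : (MvPowerSeries.coeff 0 (fieldR hV e (e j : g) (MvPowerSeries.X k)) *
              ((n k + 1 : ℕ) : ℝ)) • compC hV e (n + Finsupp.single k 1) T =
              if k = j then ((n j + 1 : ℕ) : ℝ) • compC hV e (n + Finsupp.single j 1) T
                else 0 := by
            rw [coeff_zero_fieldR_X, proj_coe, Module.Basis.coord_apply, Module.Basis.repr_self,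
              Finsupp.single_apply]
            by_cases hk : k = j
            · subst hk
              rw [if_pos rfl, if_pos rfl, one_mul]
            · rw [if_neg hk, if_neg (Ne.symm hk), zero_mul, zero_smul]
          rw [← Finset.add_sum_erase _ _ h0, h3, add_sub_cancel_left]
          refine W.sum_mem fun p hp => W.smul_of_tower_mem _ ?_
          rw [Finset.mem_erase, mem_antidiagonal] at hp
          have h4 : p.1.degree ≠ 0 := by
            rw [Ne, Finsupp.degree_eq_zero_iff]
            intro h
            apply hp.1
            rw [← hp.2, h, zero_add]
            exact Prod.ext h rfl
          have h5 : p.1.degree + p.2.degree = n.degree := by rw [← map_add, hp.2]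
          exact ih _ (by rw [map_add, Finsupp.degree_single]; omega) _ rfl T hT
        have h6 := W.sum_mem fun k (_ : k ∈ Finset.univ) => h2 k
        rw [Finset.sum_sub_distrib, W.sub_mem_iff_right h1, Finset.sum_ite_eq' Finset.univ j,
          if_pos (Finset.mem_univ j)] at h6
        have h7 := W.smul_of_tower_mem (((n j + 1 : ℕ) : ℝ)⁻¹) h6
        rwa [inv_smul_smul₀ (by positivity)] at h7
      · refine W.sum_mem fun p hp => isoActC_mem hV hl (coeff_isoSer_mem hV e _ _ _) ?_
        rw [mem_antidiagonal] at hp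
        have h5 : p.1.degree + p.2.degree = n.degree := by rw [← map_add, hp]
        exact ih p.2.degree (by omega) _ rfl T hT
  exact fun T hT m => key _ m rfl T hT

/-- Nakayama's lemma: modulo the maximal ideal, a field with coefficients in the space of values of
`M` is its value at `0`, which some element of `M` shares. -/
theorem starModule_valueSubmodule
    {M : Submodule (ℂ ⊗[ℝ] FPS ι) (ℂ ⊗[ℝ] Der ι)} (hM : M ∈ invariantModules hV e) :
    starModule hV e (valueSubmodule hV e M) = M := by
  rw [starModule_eq_coeffModule]
  have hle := le_coeffModule_of_invariant hV e hM
  set W := (valueSubmodule hV e M).comap (inclC V) with hW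
  refine le_antisymm ?_ hle
  have hfg : (coeffModule hV e W).FG := by
    obtain ⟨u, -, h⟩ := coeffModule_eq_span hV e W
    rw [h]
    exact Submodule.fg_span (Set.finite_range _)
  refine Submodule.le_of_le_smul_of_le_jacobson_bot hfg ker_constCoeffC_le_jacobson fun T hT => ?_
  obtain ⟨S, hS, h⟩ := (mem_valueSubmodule hV e).1 (hT 0)
  rw [projC_inclC] at h
  obtain ⟨q, hq, hq'⟩ := exists_projection W
  rw [← add_sub_cancel S T]
  refine Submodule.add_mem_sup hS ?_
  have hTS : T - S ∈ coeffModule hV e W := Submodule.sub_mem _ hT (hle hS)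
  -- `T - S` vanishes at `0`, so its coordinate series have zero constant term; projecting by `q`
  -- keeps the generating fields inside the module.
  rw [eq_sum_coordSerC_smul hV e q fun m => hq' _ (hTS m)]
  refine Submodule.sum_mem _ fun j _ =>
    Submodule.smul_mem_smul ?_ (fieldC_mem_coeffModule hV e (hq _))
  rw [RingHom.mem_ker, constCoeffC_apply, coeffC_coordSerC, map_sub, h, sub_self, map_zero]

end Complexification

end TransPair

end

theorem theorem7p5 {g₀ : Type*} [LieRing g₀] [LieAlgebra ℝ g₀] [TopologicalSpace g₀]
    (i₀ : LieSubalgebra ℝ g₀) (hpair : TransPair.IsTransitivePair g₀ i₀)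
    (V : Submodule ℝ g₀) (hV : IsCompl V i₀.toSubmodule)
    {ι : Type*} [Fintype ι] (e : Module.Basis ι ℝ V) :
    Set.BijOn (TransPair.starModule hV e)
        (TransPair.isotropySubmodules i₀) (TransPair.invariantModules hV e) ∧
      Set.InvOn (TransPair.valueSubmodule hV e) (TransPair.starModule hV e)
        (TransPair.isotropySubmodules i₀) (TransPair.invariantModules hV e) := by
  have hinv : Set.InvOn (TransPair.valueSubmodule hV e) (TransPair.starModule hV e)
      (TransPair.isotropySubmodules i₀) (TransPair.invariantModules hV e) :=
    ⟨fun _ hl => TransPair.valueSubmodule_starModule hV e hl,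
      fun _ hM => TransPair.starModule_valueSubmodule hV e hM⟩
  exact ⟨hinv.bijOn (fun _ hl => TransPair.starModule_mem_invariantModules hV e hl)
    (fun _ hM => TransPair.valueSubmodule_mem_isotropySubmodules hV e hM), hinv⟩
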